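/- **Setting.** Let $d>2$, $N\ge 1$, $V_c\simeq\mathbb C^N$ for $c\in\{1,\dots,d\}$, $V_C=\bigotimes_{c\in C}V_c$ and $E_d=V_{\{1,\dots,d\}}$. A *bubble* is a connected bipartite graph, regular of degree $d$, with edges colored by $\{1,\dots,d\}$ such that each color is incident exactly once to each vertex. Its polynomial $B(T,\bar T)$ puts $T\in E_d$ on each white vertex and $\bar T$ on each black vertex, and for every edge of color $c$ contracts the indices in position $c$ at its two ends. A $C$-bidipole insertion ($\emptyset\ne C\subsetneq\{1,\dots,d\}$) replaces a vertex by three vertices $v,\bar v,w$, with $\bar v$ joined to $w$ by the colors in $C$ and to $v$ by the colors not in $C$, the former edges with colors in $C$ being attached to $v$ and the others to $w$. A bubble is *generalized melonic* (GM) if it is obtained from the two-vertex bubble by bidipole insertions. A plane tree $\mathcal T$ with one marked corner per vertex, and with a non-empty color set $C_e$ on each edge ($|C_e|\le d/2$, and $1\in C_e$ if $|C_e|=d/2$), *encodes* a bubble as follows. Give each half-edge $h$, belonging to the edge $e=\{h,h'\}$, a white and a black vertex. Join the white vertex of $h$ to the black vertex of $h$ by the colors not in $C_e$, and to the black vertex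 of $h'$ by the colors in $C_e$. For each unmarked corner, going counter-clockwise from $h_1$ to $h_2$, draw a dashed line from the white vertex of $h_1$ to the black vertex of $h_2$. Contracting all dashed lines gives the bubble. For $s\in\mathbb R$ the partition function $$Z_N(t)=\int dT\,d\bar T\,\exp\bigl(-(T|T)-N^{s}t\,B(T,\bar T)\bigr),\qquad (T|T)=\sum_a T_a\bar T_a,$$ is understood as a formal power series in $t$: the integrand is expanded in $t$ and each coefficient is integrated. All integrals over complex variables are with respect to $dz\,d\bar z=\frac1\pi\,d\mathrm{Re}\,z\,d\mathrm{Im}\,z$ for each coordinate. **Theorem.** Let $B$ be a GM bubble with $V\geq 4$ vertices. There is a tree $\mathcal T$ as above that encodes $B$. Moreover, let $\mathcal T$ be any such tree. Associate to each edge $e=\{h_1,h_2\}$ (its two halves being labelled in an arbitrary way) a complex matrix $X_e\in V_{C_e}^*\otimes V_{C_e}$, set $X_{h_1}=X_e$ and $X_{h_2}=X_e^\dagger$, and let $\tilde X_h\in E_d^*\otimes E_d$ be the extension of $X_h$ by the identity on the colors not in $C_e$. Let $\epsilon_h\in\{1,-1\}$ be signs with $\prod_h\epsilon_h=-1$ (for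 instance all equal to $1$ except one). Then, as formal power series in $t^{1/(V-2)}$, $$Z_N(t)=\int\prod_{e\in\mathcal T}dX_e\,dX_e^\dagger\ \exp\Bigl(-\sum_{e\in\mathcal T}\mathrm{tr}_{V_{C_e}}(X_eX_e^\dagger)-\mathrm{tr}_{E_d}\ln\Bigl(\mathbb 1_{E_d}-\sum_{v\in\mathcal T}\ \prod_{h\text{ at }v}^{\circlearrowleft}(N^{s}t)^{\frac1{V-2}}\,\epsilon_h\tilde X_h\Bigr)\Bigr),$$ where each product runs over the half-edges at $v$ in counter-clockwise order starting from the marked corner, and where the right-hand side is expanded in powers of $t^{1/(V-2)}$ and integrated coefficient by coefficient. All the integrals that define the coefficients on both sides converge absolutely. -/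

import Mathlib

namespace GMModel

/-! Bubbles and tensorial interactions. -/

/-- A finite bipartite graph (white vertices `W`, black vertices `K`), regular of degree `d`,
whose edges carry colors in `Fin d` such that every color is incident exactly once to every
vertex: the edges of color `c` form the perfect matching `edge c`. Bubbles are the connected
ones among these. -/
structure ColoredGraph (d : ℕ) where
  W : Type
  K : Type
  [fintypeW : Fintype W]
  [fintypeK : Fintype K]
  [decW : DecidableEq W]
  [decK : DecidableEq K]
  edge : Fin d → W ≃ K

attribute [instance] ColoredGraph.fintypeW ColoredGraph.fintypeK
attribute [instance] ColoredGraph.decW ColoredGraph.decK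

namespace ColoredGraph

variable {d : ℕ}

/-- The number of vertices. -/
def numVert (B : ColoredGraph d) : ℕ := Fintype.card B.W + Fintype.card B.K

/-- Color-preserving isomorphism. -/
def Iso (B B' : ColoredGraph d) : Prop :=
  ∃ (f : B.W ≃ B'.W) (g : B.K ≃ B'.K), ∀ c w, g (B.edge c w) = B'.edge c (f w)

/-- The graph with two vertices joined by `d` edges. -/
def twoVertex (d : ℕ) : ColoredGraph d where
  W := Unit
  K := Unit
  edge := fun _ => Equiv.refl Unit

/-- `C`-bidipole insertion at the white vertex `x`. The new vertices are `v = none` (white) and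
`v̄ = none` (black), and `w` is `some x`. The colors in `C` join `w` to `v̄` and the other colors
join `v` to `v̄`; the former edges of `x` with colors in `C` are now attached to `v`, and those
with the other colors to `w`. -/
def insertWhite (B : ColoredGraph d) (C : Finset (Fin d)) (x : B.W) : ColoredGraph d where
  W := Option B.W
  K := Option B.K
  edge := fun c =>
    if c ∈ C then (Equiv.swap (some x) none).trans (Equiv.optionCongr (B.edge c))
    else Equiv.optionCongr (B.edge c)

/-- `C`-bidipole insertion at the black vertex `y` (exchange black and white above). -/
def insertBlack (B : ColoredGraph d) (C : Finset (Fin d)) (y : B.K) : ColoredGraph d where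
  W := Option B.W
  K := Option B.K
  edge := fun c =>
    if c ∈ C then (Equiv.optionCongr (B.edge c)).trans (Equiv.swap (some y) none)
    else Equiv.optionCongr (B.edge c)

/-- Generalized melonic bubbles: those built from the two-vertex bubble by bidipole insertions.
The set `C` is neither empty nor everything, since the graph has to remain connected. -/
inductive IsGM : ColoredGraph d → Prop
  | two : IsGM (twoVertex d)
  | insertWhite (B : ColoredGraph d) (C : Finset (Fin d)) (x : B.W) :
      IsGM B → C.Nonempty → C ≠ Finset.univ → IsGM (B.insertWhite C x)
  | insertBlack (B : ColoredGraph d) (C : Finset (Fin d)) (y : B.K) :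
      IsGM B → C.Nonempty → C ≠ Finset.univ → IsGM (B.insertBlack C y)
  | iso (B B' : ColoredGraph d) : B.Iso B' → IsGM B → IsGM B'

/-- The bubble polynomial `B(T, T̄)` of a tensor `T` with `d` indices in `Fin N`: a copy of `T` on
each white vertex, a copy of `T̄` on each black vertex, and an index `a c w` summed over `Fin N`
for the edge of color `c` incident to the white vertex `w`. -/
noncomputable def poly (B : ColoredGraph d) {N : ℕ} (T : (Fin d → Fin N) → ℂ) : ℂ :=
  ∑ a : Fin d → B.W → Fin N,
    (∏ w : B.W, T (fun c => a c w)) *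
      ∏ k : B.K, (starRingEnd ℂ) (T (fun c => a c ((B.edge c).symm k)))

end ColoredGraph

/-! Colored graphs with dashed lines, and the contraction of the dashed lines. -/

/-- A colored graph with additional dashed lines, each between a white and a black vertex; every
vertex is incident to at most one dashed line. -/
structure DashedGraph (d : ℕ) where
  W : Type
  K : Type
  edge : Fin d → W ≃ K
  dash : W → K → Prop
  dash_left : ∀ w k k', dash w k → dash w k' → k = k'
  dash_right : ∀ w w' k, dash w k → dash w' k → w = w'

namespace DashedGraph

variable {d : ℕ}

/-- Paths that start at a white vertex with an edge of color `c`, alternate edges of color `c` and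
dashed lines, and end at a black vertex with an edge of color `c`. -/
inductive Path (G : DashedGraph d) (c : Fin d) : G.W → G.K → Prop
  | single (w : G.W) : Path G c w (G.edge c w)
  | step (w : G.W) (k : G.K) (w' : G.W) :
      Path G c w k → G.dash w' k → Path G c w (G.edge c w')

/-- `B` is (isomorphic to) the boundary `∂ G`, obtained by contracting all dashed lines: its
vertices are the vertices of `G` without dashed line, and its edges of color `c` are the maximal
paths of `G` that alternate the color `c` and dashed lines. -/
def IsBoundary (G : DashedGraph d) (B : ColoredGraph d) : Prop :=
  ∃ (f : B.W ≃ {w : G.W // ∀ k, ¬ G.dash w k}) (g : B.K ≃ {k : G.K // ∀ w, ¬ G.dash w k}),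
    ∀ c w, G.Path c (f w).1 (g (B.edge c w)).1

end DashedGraph

/-! Plane trees. -/

/-- Admissible color sets: non-empty, at most `d / 2` colors, and the first color belongs to the
set if there are exactly `d / 2`. -/
def Admissible {d : ℕ} (C : Finset (Fin d)) : Prop :=
  C.Nonempty ∧ 2 * C.card ≤ d ∧ (2 * C.card = d → ∃ c ∈ C, (c : ℕ) = 0)

/-- A plane tree with one marked corner at each vertex and an admissible color set on each edge.
The half-edges at the vertex `v` are numbered `0, …, deg v - 1` in counter-clockwise order,
starting from the marked corner of `v`; the two halves of each edge are exchanged by `twin`.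
A connected graph is a tree when it has one more vertex than edges. -/
structure PlaneTree (d : ℕ) where
  Vert : Type
  [fintypeVert : Fintype Vert]
  deg : Vert → ℕ
  twin : (Σ v, Fin (deg v)) → (Σ v, Fin (deg v))
  twin_twin : ∀ h, twin (twin h) = h
  twin_ne : ∀ h, twin h ≠ h
  color : (Σ v, Fin (deg v)) → Finset (Fin d)
  color_twin : ∀ h, color (twin h) = color h
  color_admissible : ∀ h, Admissible (color h)
  connected : (SimpleGraph.fromRel fun v w => ∃ h, h.1 = v ∧ (twin h).1 = w).Connected
  card_vert : 2 * Fintype.card Vert = Fintype.card (Σ v, Fin (deg v)) + 2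

attribute [instance] PlaneTree.fintypeVert

namespace PlaneTree

variable {d : ℕ} (S : PlaneTree d)

/-- Half-edges. -/
abbrev Half : Type := Σ v, Fin (S.deg v)

/-- The graph of quartic bubbles and dashed lines represented by the tree. Each half-edge `h` is a
pair of a white vertex and a black vertex, both named `h`. The edge `{h, twin h}` with color set
`C` is the quartic bubble where the colors outside `C` join white `h` to black `h` and the
colors in `C` join white `h` to black `twin h`. An unmarked corner, from `h` to the next
half-edge `h'` in counter-clockwise order, is a dashed line from white `h` to black `h'`. -/
def toGraph : DashedGraph d where
  W := S.Half
  K := S.Half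
  edge := fun c =>
    { toFun := fun h => if c ∈ S.color h then S.twin h else h
      invFun := fun h => if c ∈ S.color h then S.twin h else h
      left_inv := by
        intro h
        by_cases hc : c ∈ S.color h <;> simp [hc, S.color_twin, S.twin_twin]
      right_inv := by
        intro h
        by_cases hc : c ∈ S.color h <;> simp [hc, S.color_twin, S.twin_twin] }
  dash := fun h h' => h.1 = h'.1 ∧ (h.2 : ℕ) + 1 = (h'.2 : ℕ)
  dash_left := by
    rintro ⟨v, i⟩ ⟨v', j⟩ ⟨v'', k⟩ ⟨h1, h2⟩ ⟨h3, h4⟩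
    dsimp only at h1 h2 h3 h4
    subst h1
    subst h3
    have : j = k := Fin.ext (by omega)
    rw [this]
  dash_right := by
    rintro ⟨v, i⟩ ⟨v', j⟩ ⟨v'', k⟩ ⟨h1, h2⟩ ⟨h3, h4⟩
    dsimp only at h1 h2 h3 h4
    subst h1
    subst h3
    have : i = j := Fin.ext (by omega)
    rw [this]

/-- `o` contains exactly one half-edge of each edge, namely the one that carries `X_e`
(the other one carries `X_e†`). The edges are then identified with the elements of `o`. -/
def IsOrientation (o : Finset S.Half) : Prop := ∀ h, S.twin h ∈ o ↔ h ∉ o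

/-- The complex coordinates of a family of matrices `X_e` on `V_{C_e}`, one for each edge. -/
abbrev Coord (o : Finset S.Half) (N : ℕ) : Type :=
  Σ e : o, (S.color e.1 → Fin N) × (S.color e.1 → Fin N)

/-- The matrix `X_e` with the given coordinates. -/
def mat {o : Finset S.Half} {N : ℕ} (z : S.Coord o N → ℂ) (e : o) :
    Matrix (S.color e.1 → Fin N) (S.color e.1 → Fin N) ℂ :=
  Matrix.of fun i j => z ⟨e, i, j⟩

end PlaneTree

/-- Extension of a matrix on `V_C` to `E_d` by the identity on the colors outside `C`. -/
noncomputable def extend {d N : ℕ} (C : Finset (Fin d))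
    (M : Matrix (C → Fin N) (C → Fin N) ℂ) :
    Matrix (Fin d → Fin N) (Fin d → Fin N) ℂ :=
  Matrix.of fun a b =>
    M (fun c => a c.1) (fun c => b c.1) * ∏ c ∈ Cᶜ, if a c = b c then 1 else 0

open Classical in
/-- The matrix `X̃_h` on `E_d`: the extension of `X_h`, where `X_h = X_e` on the half-edge of
`e` that belongs to `o`, and `X_h = X_e†` on the other one. It is zero if the edge of `h` has no
half in `o`, which does not occur for an orientation. -/
noncomputable def PlaneTree.tildeMat {d : ℕ} (S : PlaneTree d) {o : Finset S.Half} {N : ℕ}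
    (z : S.Coord o N → ℂ) (h : S.Half) : Matrix (Fin d → Fin N) (Fin d → Fin N) ℂ :=
  if hh : h ∈ o then extend (S.color h) (S.mat z ⟨h, hh⟩)
  else if ht : S.twin h ∈ o then
    extend (S.color (S.twin h)) (S.mat z ⟨S.twin h, ht⟩).conjTranspose
  else 0

/-! Formal power series. -/

/-- The exponential of a formal power series, `e^{f₀} exp(f - f₀)` with `f₀` the constant term. -/
noncomputable def fexp (f : PowerSeries ℂ) : PowerSeries ℂ :=
  PowerSeries.C (Complex.exp (PowerSeries.constantCoeff f)) *
    (PowerSeries.exp ℂ).subst (f - PowerSeries.C (PowerSeries.constantCoeff f))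

/-- The logarithm `ln A = - ∑_{m ≥ 1} (1 - A)^m / m` of a matrix `A` of formal power series whose
constant term is the identity matrix (the terms `m > n` do not contribute to order `n`). -/
noncomputable def matLog {n : Type*} [Fintype n] [DecidableEq n]
    (A : Matrix n n (PowerSeries ℂ)) : Matrix n n (PowerSeries ℂ) :=
  Matrix.of fun i j => PowerSeries.mk fun k =>
    - ∑ m ∈ Finset.Icc 1 k, PowerSeries.coeff k (((1 - A) ^ m) i j) / (m : ℂ)

/-- All coefficients of a formal power series that depends on `z : ι → ℂ` are integrable. -/
def FormallyIntegrable {ι : Type*} [Fintype ι] (F : (ι → ℂ) → PowerSeries ℂ) : Prop :=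
  ∀ n, MeasureTheory.Integrable fun z => PowerSeries.coeff n (F z)

/-- Coefficientwise integral `∫ ∏ᵢ dzᵢ dz̄ᵢ F(z)` of a formal power series that depends on
`z : ι → ℂ`. Here `dz dz̄` is Lebesgue measure divided by `π`, so that
`∫ dz dz̄ exp (- z z̄) = 1`. -/
noncomputable def formalIntegral {ι : Type*} [Fintype ι]
    (F : (ι → ℂ) → PowerSeries ℂ) : PowerSeries ℂ :=
  PowerSeries.mk fun n =>
    ((Real.pi : ℂ) ^ Fintype.card ι)⁻¹ * ∫ z : ι → ℂ, PowerSeries.coeff n (F z)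

/-! The two models. -/

/-- `exp (-(T|T) - N^s t B(T, T̄))` as a formal power series in `t`. -/
noncomputable def tensorWeight {d : ℕ} (B : ColoredGraph d) (N : ℕ) (s : ℝ)
    (T : (Fin d → Fin N) → ℂ) : PowerSeries ℂ :=
  fexp (- PowerSeries.C (∑ a, T a * (starRingEnd ℂ) (T a)) -
    PowerSeries.C (((N : ℝ) ^ s : ℝ) : ℂ) * PowerSeries.X * PowerSeries.C (B.poly T))

/-- The partition function of the tensor model, as a formal power series in `t`. -/
noncomputable def tensorZ {d : ℕ} (B : ColoredGraph d) (N : ℕ) (s : ℝ) : PowerSeries ℂ :=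
  formalIntegral (tensorWeight B N s)

/-- The sum over the vertices of the tree of the counter-clockwise products of
`g ε_h X̃_h`, as a matrix on `E_d` of formal power series. -/
noncomputable def vertexSum {d : ℕ} (S : PlaneTree d) {o : Finset S.Half} {N : ℕ}
    (ε : S.Half → ℤˣ) (g : PowerSeries ℂ) (z : S.Coord o N → ℂ) :
    Matrix (Fin d → Fin N) (Fin d → Fin N) (PowerSeries ℂ) :=
  ∑ v, (List.ofFn fun i : Fin (S.deg v) =>
    (g * PowerSeries.C (((ε ⟨v, i⟩ : ℤˣ) : ℤ) : ℂ)) •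
      (S.tildeMat z ⟨v, i⟩).map PowerSeries.C).prod

/-- `exp (- ∑_e tr (X_e X_e†) - tr ln (1 - ∑_v ∏_h g ε_h X̃_h))`. -/
noncomputable def matrixWeight {d : ℕ} (S : PlaneTree d) (o : Finset S.Half) (N : ℕ)
    (ε : S.Half → ℤˣ) (g : PowerSeries ℂ) (z : S.Coord o N → ℂ) : PowerSeries ℂ :=
  fexp (- PowerSeries.C (∑ e : o, (S.mat z e * (S.mat z e).conjTranspose).trace) -
    (matLog (1 - vertexSum S ε g z)).trace)

/-- The partition function of the matrix model. -/
noncomputable def matrixZ {d : ℕ} (S : PlaneTree d) (o : Finset S.Half) (N : ℕ)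
    (ε : S.Half → ℤˣ) (g : PowerSeries ℂ) : PowerSeries ℂ :=
  formalIntegral (matrixWeight S o N ε g)

/-- `(N^s t)^{1/(V-2)}` as a formal power series in the variable `t^{1/(V-2)}`. -/
noncomputable def coupling (N : ℕ) (s : ℝ) (V : ℕ) : PowerSeries ℂ :=
  PowerSeries.C ((((N : ℝ) ^ s) ^ (1 / ((V : ℝ) - 2)) : ℝ) : ℂ) * PowerSeries.X

end GMModel

/-! The two models are the two partial integrations of one Gaussian model in both `T` and the `X_e`,
with exponent `mixedAction`, that is `T̄ (∑ v, ∏ h, g ε_h X̃_h) T` where `g = (N^s t)^(1/(V-2))`.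

Integrating `T` at fixed `X` is a Gaussian integral with a quadratic source. It gives the inverse
determinant of `1 - ∑ v, ∏ h, g ε_h X̃_h`, the exponential of minus the trace of the logarithm
(`gaussSeries_expSeries_quadraticForm`).

Integrating the `X_e` at fixed `T` uses the tree. The field of a half-edge is correlated only with
that of its twin. Differentiate the integral in the formal variable, which brings down one vertex
term, and integrate by parts its half-edges: each brings down the vertex at the other end of its
edge, and then the half-edges of that vertex do the same. In a tree no vertex is reached twice, so
every vertex is brought down exactly once and no field is left. The integral `F` therefore satisfies
`F' = κ (∏ v, u v)' F`, where `u v` is the coupling of `v` and `κ` is the full contraction of the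
tree, so `F = exp (κ ∏ v, u v)` (`gaussSeries_expSeries_interaction`). Matrix products identify
indices along dashed lines and covariances identify them along colored edges, so `κ = B(T, T̄)`
(`fullContraction_eq_poly`). No path of dashed lines and edges of one color closes up
(`wellFounded_dash_edge`), so no stray power of `N` appears. There are `V - 2` half-edges and the
signs multiply to `-1`, so `∏ v, u v = -N^s t`.

Each coefficient is a polynomial times a Gaussian, which gives absolute convergence and Fubini
(`coeff_matrixZ`).

A tree is found by induction on bidipole insertions. An insertion attaches a leaf next to the marked
corner of a vertex, after the marked corner for a black vertex and before it for a white one;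
replacing `C` by its complement changes the bubble only up to isomorphism, so `C` may be taken
admissible. -/

namespace GMModel

open PowerSeries

/-! ### Exponentials of power series over a ℂ-algebra. -/

section ExpSeries

variable {A : Type*} [CommRing A] [Algebra ℂ A]

/-- The exponential `∑ W ^ m / m!` of a power series `W` without constant term (the terms `m > n`
do not contribute to order `n`). -/
noncomputable def expSeries (W : A⟦X⟧) : A⟦X⟧ :=
  PowerSeries.mk fun n => ∑ m ∈ Finset.range (n + 1), ((m.factorial : ℂ)⁻¹) • coeff n (W ^ m)

theorem coeff_pow_eq_zero {R : Type*} [CommRing R] {W : R⟦X⟧} (hW : constantCoeff W = 0)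
    {n m : ℕ} (h : n < m) : coeff n (W ^ m) = 0 :=
  X_pow_dvd_iff.1 (pow_dvd_pow_of_dvd (X_dvd_iff.2 hW) m) n h

theorem coeff_expSeries {W : A⟦X⟧} (hW : constantCoeff W = 0) {n K : ℕ} (h : n < K) :
    coeff n (expSeries W) = ∑ m ∈ Finset.range K, ((m.factorial : ℂ)⁻¹) • coeff n (W ^ m) := by
  rw [expSeries, coeff_mk]
  refine Finset.sum_subset (Finset.range_mono (by omega)) fun m _ hm => ?_
  rw [coeff_pow_eq_zero hW (by simpa using hm), smul_zero]

theorem constantCoeff_expSeries (W : A⟦X⟧) : constantCoeff (expSeries W) = 1 := by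
  rw [← coeff_zero_eq_constantCoeff_apply, expSeries, coeff_mk]
  simp

theorem map_expSeries {B : Type*} [CommRing B] [Algebra ℂ B] (φ : A →ₐ[ℂ] B) (W : A⟦X⟧) :
    PowerSeries.map (φ : A →+* B) (expSeries W) = expSeries (PowerSeries.map (φ : A →+* B) W) := by
  ext n
  simp only [expSeries, coeff_map, coeff_mk, ← map_pow, RingHom.coe_coe, map_sum, map_smul]

/-- Partial sums of the exponential series. -/
noncomputable def expPartial (W : A⟦X⟧) (K : ℕ) : A⟦X⟧ :=
  ∑ m ∈ Finset.range K, ((m.factorial : ℂ)⁻¹) • W ^ m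

theorem X_pow_dvd_expSeries_sub {W : A⟦X⟧} (hW : constantCoeff W = 0) (K : ℕ) :
    X ^ K ∣ expSeries W - expPartial W K := by
  rw [X_pow_dvd_iff]
  intro n hn
  rw [map_sub, coeff_expSeries hW hn, expPartial, map_sum, sub_eq_zero]
  rfl

theorem derivation_expPartial (δ : Derivation ℂ A⟦X⟧ A⟦X⟧) (W : A⟦X⟧) (K : ℕ) :
    δ (expPartial W (K + 1)) = expPartial W K * δ W := by
  rw [expPartial, Finset.sum_range_succ', map_add, map_sum, expPartial, Finset.sum_mul]
  have h0 : δ (((Nat.factorial 0 : ℂ)⁻¹) • W ^ 0) = 0 := by simp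
  rw [h0, add_zero]
  refine Finset.sum_congr rfl fun m _ => ?_
  rw [δ.map_smul, δ.leibniz_pow, Nat.add_sub_cancel, Nat.factorial_succ, smul_mul_assoc,
    ← Nat.cast_smul_eq_nsmul ℂ, smul_smul, smul_eq_mul]
  congr 1
  have : (m.factorial : ℂ) ≠ 0 := by exact_mod_cast m.factorial_ne_zero
  have : ((m : ℂ) + 1) ≠ 0 := by exact_mod_cast m.succ_ne_zero
  push_cast
  field_simp

/-- A derivation lowers the `X`-adic order by at most one, so the identity at order `n` follows from
partial sums exact up to orders `n + 2` and `n + 1`. It serves both for `d/dX` and for derivatives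
in the Gaussian variables. -/
theorem derivation_expSeries (δ : Derivation ℂ A⟦X⟧ A⟦X⟧) {W : A⟦X⟧} (hW : constantCoeff W = 0) :
    δ (expSeries W) = expSeries W * δ W := by
  ext n
  obtain ⟨a, ha⟩ := X_pow_dvd_expSeries_sub hW (n + 2)
  obtain ⟨b, hb⟩ := X_pow_dvd_expSeries_sub hW (n + 1)
  have ha' : expSeries W = X ^ (n + 2) * a + expPartial W (n + 2) := by rw [← ha]; ring
  have hb' : expPartial W (n + 1) = expSeries W - X ^ (n + 1) * b := by rw [← hb]; ring
  have hδ : δ (expSeries W) - expSeries W * δ W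
      = X ^ (n + 1) * (X * δ a + (n + 2) • (a * δ X) - b * δ W) := by
    conv_lhs => rw [ha']
    rw [map_add, derivation_expPartial, hb', ← ha', δ.leibniz, δ.leibniz_pow]
    simp only [smul_eq_mul, nsmul_eq_mul, show n + 2 - 1 = n + 1 from rfl]
    ring
  have := X_pow_dvd_iff.1 (Dvd.intro _ hδ.symm) n (Nat.lt_succ_self n)
  rwa [map_sub, sub_eq_zero] at this

end ExpSeries

/-- A first-order linear equation determines the coefficients recursively in characteristic zero.
Both Gaussian integrals below are evaluated this way. -/
theorem eq_of_derivative_eq_mul {F G u : ℂ⟦X⟧} (hF : d⁄dX ℂ F = F * u) (hG : d⁄dX ℂ G = G * u)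
    (h0 : constantCoeff F = constantCoeff G) : F = G := by
  ext n
  induction n using Nat.strong_induction_on with
  | _ n ih =>
    cases n with
    | zero => simpa using h0
    | succ n =>
      have h1 := congrArg (coeff n) hF
      have h2 := congrArg (coeff n) hG
      rw [coeff_derivative, coeff_mul] at h1 h2
      have h3 : coeff (n + 1) F * ((n : ℂ) + 1) = coeff (n + 1) G * ((n : ℂ) + 1) := by
        rw [h1, h2]
        refine Finset.sum_congr rfl fun p hp => ?_
        rw [ih p.1 (by have := Finset.HasAntidiagonal.mem_antidiagonal.1 hp; omega)]
      exact mul_right_cancel₀ (by exact_mod_cast n.succ_ne_zero) h3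

theorem derivative_expSeries {W : ℂ⟦X⟧} (hW : constantCoeff W = 0) :
    d⁄dX ℂ (expSeries W) = expSeries W * d⁄dX ℂ W :=
  derivation_expSeries _ hW

theorem fexp_eq (f : ℂ⟦X⟧) :
    fexp f = C (Complex.exp (constantCoeff f)) * expSeries (f - C (constantCoeff f)) := by
  have h0 : constantCoeff (f - C (constantCoeff f)) = 0 := by simp
  rw [fexp]
  congr 1
  ext n
  rw [coeff_subst' (HasSubst.of_constantCoeff_zero' h0), expSeries, coeff_mk,
    finsum_eq_sum_of_support_subset (s := Finset.range (n + 1))]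
  · refine Finset.sum_congr rfl fun m _ => ?_
    simp [coeff_exp]
  · intro m hm
    by_contra h
    refine hm ?_
    dsimp only
    rw [coeff_pow_eq_zero h0 (by simpa using h), smul_zero]

theorem coeff_expSeries_C_mul_X_pow {k : ℕ} (hk : k ≠ 0) (c : ℂ) (n : ℕ) :
    coeff n (expSeries (C c * X ^ k)) =
      if k ∣ n then ((n / k).factorial : ℂ)⁻¹ * c ^ (n / k) else 0 := by
  have h : ∀ m, coeff n ((C c * X ^ k : ℂ⟦X⟧) ^ m) = if n = k * m then c ^ m else 0 := by
    intro m
    rw [mul_pow, ← map_pow, coeff_C_mul, ← pow_mul, coeff_X_pow]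
    simp
  rw [expSeries, coeff_mk]
  split_ifs with hd
  · obtain ⟨m, rfl⟩ := hd
    rw [Nat.mul_div_cancel_left m (Nat.pos_of_ne_zero hk), Finset.sum_eq_single m]
    · rw [h, if_pos rfl, smul_eq_mul]
    · intro b _ hb
      rw [h, if_neg, smul_zero]
      exact fun h => hb (Nat.eq_of_mul_eq_mul_left (Nat.pos_of_ne_zero hk) h).symm
    · intro hm
      refine absurd (Finset.mem_range.2 ?_) hm
      have := Nat.le_mul_of_pos_left m (Nat.pos_of_ne_zero hk)
      omega
  · refine Finset.sum_eq_zero fun m _ => ?_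
    rw [h, if_neg, smul_zero]
    exact fun h => hd ⟨m, h⟩

theorem coeff_expSeries_C_mul_X (c : ℂ) (n : ℕ) :
    coeff n (expSeries (C c * X)) = (n.factorial : ℂ)⁻¹ * c ^ n := by
  simpa using coeff_expSeries_C_mul_X_pow one_ne_zero c n

/-! ### Complex Gaussian moments and integration by parts. -/

section Gaussian

open MeasureTheory

theorem gaussian_moment_norm (n : ℕ) :
    ∫ z : ℂ, ‖z‖ ^ n * Real.exp (-(‖z‖ ^ 2)) = Real.pi * Real.Gamma ((n + 2) / 2) := by
  have h := Complex.integral_rpow_mul_exp_neg_rpow (p := 2) (q := n) (by norm_num)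
    (by have : (0 : ℝ) ≤ n := n.cast_nonneg
        linarith)
  rw [show 2 * Real.pi / 2 = Real.pi by ring] at h
  rw [← h]
  simp only [Real.rpow_natCast, Real.rpow_ofNat]

/-- The Bochner integral of a non-integrable function is `0`, whereas the moment is a positive value
of Gamma times `π`. -/
theorem integrable_gaussian_norm (n : ℕ) :
    Integrable fun z : ℂ => ‖z‖ ^ n * Real.exp (-(‖z‖ ^ 2)) := by
  by_contra h
  have h0 := gaussian_moment_norm n
  rw [integral_undef h] at h0
  have : 0 < Real.pi * Real.Gamma (((n : ℝ) + 2) / 2) := by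
    have : 0 < Real.Gamma (((n : ℝ) + 2) / 2) := Real.Gamma_pos_of_pos (by positivity)
    positivity
  linarith

/-- The factor of a Gaussian monomial that belongs to one complex coordinate. -/
noncomputable def gaussFactor (a b : ℕ) (z : ℂ) : ℂ :=
  z ^ a * (starRingEnd ℂ) z ^ b * Complex.exp (-(z * (starRingEnd ℂ) z))

theorem exp_neg_mul_conj (z : ℂ) :
    Complex.exp (-(z * (starRingEnd ℂ) z)) = (Real.exp (-(‖z‖ ^ 2)) : ℝ) := by
  rw [Complex.mul_conj, Complex.normSq_eq_norm_sq]
  push_cast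
  rfl

theorem integrable_gaussFactor (a b : ℕ) : Integrable (gaussFactor a b) := by
  have hc : Continuous (gaussFactor a b) := by
    unfold gaussFactor
    have := Complex.continuous_conj
    fun_prop
  refine (integrable_gaussian_norm (a + b)).mono' hc.aestronglyMeasurable
    (Filter.Eventually.of_forall fun z => le_of_eq ?_)
  rw [gaussFactor, exp_neg_mul_conj, norm_mul, norm_mul, norm_pow, norm_pow, RCLike.norm_conj,
    pow_add, Complex.norm_real, Real.norm_of_nonneg (Real.exp_nonneg _)]

theorem integral_gaussFactor (a b : ℕ) :
    ∫ z : ℂ, gaussFactor a b z = if a = b then (Real.pi : ℂ) * a.factorial else 0 := by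
  split_ifs with h
  · subst h
    have h1 : ∀ z : ℂ, gaussFactor a a z = ((‖z‖ ^ (2 * a) * Real.exp (-(‖z‖ ^ 2)) : ℝ) : ℂ) := by
      intro z
      rw [gaussFactor, exp_neg_mul_conj, ← mul_pow, Complex.mul_conj, Complex.normSq_eq_norm_sq]
      push_cast
      rw [← pow_mul]
    simp_rw [h1]
    rw [integral_complex_ofReal, gaussian_moment_norm]
    have h2 : ((2 * a : ℕ) + 2 : ℝ) / 2 = a + 1 := by push_cast; ring
    rw [h2, Real.Gamma_nat_eq_factorial]
    push_cast
    rfl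
  · have hab : ((a : ℝ) - b) ≠ 0 := sub_ne_zero.2 (by exact_mod_cast h)
    -- The angle is chosen so that `c ^ a * conj c ^ b = exp (π i) = -1`. The rotation preserves the
    -- measure and reverses the sign of the integrand, so the integral vanishes.
    set c : Circle := Circle.exp (Real.pi / (a - b)) with hc
    have h1 := (rotation c).measurePreserving.integral_comp'
      (f := (rotation c).toMeasurableEquiv) (gaussFactor a b)
    have hu : (c : ℂ) ^ a * (starRingEnd ℂ) (c : ℂ) ^ b = -1 := by
      rw [hc, Circle.coe_exp, ← Complex.exp_conj, ← Complex.exp_nat_mul, ← Complex.exp_nat_mul,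
        ← Complex.exp_add, ← Complex.exp_pi_mul_I]
      congr 1
      simp only [map_mul, Complex.conj_I, Complex.conj_ofReal]
      have : ((a : ℂ) - b) ≠ 0 := by exact_mod_cast hab
      push_cast
      field_simp
      ring
    have h2 : ∀ z, gaussFactor a b ((rotation c).toMeasurableEquiv z) = - gaussFactor a b z := by
      intro z
      have hr : (rotation c).toMeasurableEquiv z = (c : ℂ) * z := rfl
      have hcc : (c : ℂ) * (starRingEnd ℂ) (c : ℂ) = 1 := by
        rw [Complex.mul_conj, Circle.normSq_coe, Complex.ofReal_one]
      rw [hr, gaussFactor, gaussFactor, map_mul, mul_pow, mul_pow,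
        show (c : ℂ) * z * ((starRingEnd ℂ) (c : ℂ) * (starRingEnd ℂ) z)
          = ((c : ℂ) * (starRingEnd ℂ) (c : ℂ)) * (z * (starRingEnd ℂ) z) by ring, hcc, one_mul,
        show (c : ℂ) ^ a * z ^ a * ((starRingEnd ℂ) (c : ℂ) ^ b * (starRingEnd ℂ) z ^ b)
          = ((c : ℂ) ^ a * (starRingEnd ℂ) (c : ℂ) ^ b) * (z ^ a * (starRingEnd ℂ) z ^ b) by ring,
        hu]
      ring
    simp_rw [h2] at h1
    rw [integral_neg] at h1
    linear_combination (-(1 / 2) : ℂ) * h1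

variable {ι : Type*}

/-- Evaluation of polynomials in the variables `zᵢ` (`Sum.inl i`) and `z̄ᵢ` (`Sum.inr i`). -/
noncomputable def evalZ (z : ι → ℂ) : MvPolynomial (ι ⊕ ι) ℂ →ₐ[ℂ] ℂ :=
  MvPolynomial.aeval (Sum.elim z fun i => (starRingEnd ℂ) (z i))

variable [Fintype ι]

/-- The Gaussian weight `exp (- ∑ᵢ zᵢ z̄ᵢ)`. -/
noncomputable def gaussWeight (z : ι → ℂ) : ℂ := Complex.exp (-∑ i, z i * (starRingEnd ℂ) (z i))

theorem evalZ_monomial_mul_gaussWeight (z : ι → ℂ) (s : ι ⊕ ι →₀ ℕ) (c : ℂ) :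
    evalZ z (MvPolynomial.monomial s c) * gaussWeight z =
      c * ∏ i, gaussFactor (s (Sum.inl i)) (s (Sum.inr i)) (z i) := by
  rw [evalZ, MvPolynomial.aeval_monomial, Finsupp.prod_fintype _ _ (fun _ => pow_zero _),
    Fintype.prod_sum_type, gaussWeight, ← Finset.sum_neg_distrib, Complex.exp_sum]
  simp only [gaussFactor, Sum.elim_inl, Sum.elim_inr, Finset.prod_mul_distrib, Algebra.algebraMap_self,
    RingHom.id_apply]
  ring

theorem integrable_evalZ_mul_gaussWeight (p : MvPolynomial (ι ⊕ ι) ℂ) :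
    Integrable fun z : ι → ℂ => evalZ z p * gaussWeight z := by
  induction p using MvPolynomial.induction_on' with
  | monomial s c =>
    simp_rw [evalZ_monomial_mul_gaussWeight]
    exact (Integrable.fintype_prod fun i => integrable_gaussFactor _ _).const_mul c
  | add p q hp hq =>
    simp_rw [map_add, add_mul]
    exact hp.add hq

/-- The normalized Gaussian integral of a polynomial. -/
noncomputable def gaussE : MvPolynomial (ι ⊕ ι) ℂ →ₗ[ℂ] ℂ where
  toFun p := ((Real.pi : ℂ) ^ Fintype.card ι)⁻¹ * ∫ z : ι → ℂ, evalZ z p * gaussWeight z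
  map_add' p q := by
    simp_rw [map_add, add_mul]
    rw [integral_add (integrable_evalZ_mul_gaussWeight p) (integrable_evalZ_mul_gaussWeight q),
      mul_add]
  map_smul' c p := by
    simp_rw [map_smul, smul_eq_mul, mul_assoc]
    rw [integral_const_mul]
    simp only [RingHom.id_apply]
    ring

theorem gaussE_apply (p : MvPolynomial (ι ⊕ ι) ℂ) :
    gaussE p = ((Real.pi : ℂ) ^ Fintype.card ι)⁻¹ * ∫ z : ι → ℂ, evalZ z p * gaussWeight z := rfl

theorem gaussE_monomial (s : ι ⊕ ι →₀ ℕ) (c : ℂ) :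
    gaussE (MvPolynomial.monomial s c) =
      c * ∏ i, if s (Sum.inl i) = s (Sum.inr i) then ((s (Sum.inl i)).factorial : ℂ) else 0 := by
  rw [gaussE_apply]
  simp_rw [evalZ_monomial_mul_gaussWeight]
  rw [integral_const_mul,
    integral_fintype_prod_volume_eq_prod
      (f := fun i (z : ℂ) => gaussFactor (s (Sum.inl i)) (s (Sum.inr i)) z)]
  simp_rw [integral_gaussFactor]
  have h : ∀ i : ι, (if s (Sum.inl i) = s (Sum.inr i) then
      (Real.pi : ℂ) * (s (Sum.inl i)).factorial else 0)
      = Real.pi * (if s (Sum.inl i) = s (Sum.inr i) then ((s (Sum.inl i)).factorial : ℂ) else 0) :=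
    fun i => by split_ifs <;> simp
  simp_rw [h]
  rw [Finset.prod_mul_distrib, Finset.prod_const, Finset.card_univ]
  have : (Real.pi : ℂ) ^ Fintype.card ι ≠ 0 :=
    pow_ne_zero _ (by exact_mod_cast Real.pi_ne_zero)
  field_simp

theorem gaussE_one : gaussE (1 : MvPolynomial (ι ⊕ ι) ℂ) = 1 := by
  have := gaussE_monomial (0 : ι ⊕ ι →₀ ℕ) 1
  simpa using this

/-- Gaussian integration by parts. -/
theorem gaussE_X_mul (x : ι ⊕ ι) (p : MvPolynomial (ι ⊕ ι) ℂ) :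
    gaussE (MvPolynomial.X x * p) = gaussE (MvPolynomial.pderiv x.swap p) := by
  classical
  -- The identity is checked on monomials from the explicit moments, where it amounts to `(m + 1)! =
  -- (m + 1) * m!`; no boundary term is involved.
  induction p using MvPolynomial.induction_on' with
  | add p q hp hq => rw [mul_add, map_add, hp, hq, map_add, map_add]
  | monomial s c =>
    rw [MvPolynomial.pderiv_monomial, MvPolynomial.X, MvPolynomial.monomial_mul, one_mul,
      gaussE_monomial, gaussE_monomial, mul_assoc]
    congr 1
    obtain ⟨i, hi⟩ : ∃ i, x = Sum.inl i ∨ x = Sum.inr i := by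
      rcases x with i | i
      · exact ⟨i, Or.inl rfl⟩
      · exact ⟨i, Or.inr rfl⟩
    rw [← Finset.mul_prod_erase _ _ (Finset.mem_univ i),
      ← Finset.mul_prod_erase _ _ (Finset.mem_univ i), ← mul_assoc]
    congr 1
    · rcases hi with rfl | rfl
      · simp only [Sum.swap_inl, Finsupp.add_apply, Finsupp.tsub_apply, Finsupp.single_eq_same,
          Finsupp.single_apply, reduceCtorEq, if_false, zero_add, tsub_zero]
        rcases h : s (Sum.inr i) with _ | m
        · simp
        · rw [add_comm 1]
          simp only [Nat.add_right_cancel_iff, Nat.add_sub_cancel]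
          split_ifs with h2
          · rw [h2, Nat.factorial_succ]
            push_cast
            ring
          · simp
      · simp only [Sum.swap_inr, Finsupp.add_apply, Finsupp.tsub_apply, Finsupp.single_eq_same,
          Finsupp.single_apply, reduceCtorEq, if_false, zero_add, tsub_zero]
        rcases h : s (Sum.inl i) with _ | m
        · simp
          intro h
          omega
        · rw [add_comm 1]
          simp only [Nat.add_right_cancel_iff, Nat.add_sub_cancel]
          split_ifs with h2
          · rw [Nat.factorial_succ]
            push_cast
            ring
          · simp
    · refine Finset.prod_congr rfl fun j hj => ?_
      have hj := (Finset.mem_erase.1 hj).1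
      rcases hi with rfl | rfl <;>
      simp [hj.symm]

end Gaussian

/-! ### Linear maps, derivations and Gaussian integrals acting on coefficients. -/

section Coefficientwise

variable {R A B : Type*} [CommSemiring R]

/-- Coefficientwise extension of a linear map to power series. -/
noncomputable def mapCoeff [CommRing A] [CommRing B] [Module R A] [Module R B] (L : A →ₗ[R] B) :
    A⟦X⟧ →ₗ[R] B⟦X⟧ where
  toFun f := PowerSeries.mk fun n => L (coeff n f)
  map_add' f g := by ext n; simp
  map_smul' c f := by
    ext n
    have h : coeff n (c • f) = c • coeff n f := rfl
    have h' : ∀ g : B⟦X⟧, coeff n (c • g) = c • coeff n g := fun _ => rfl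
    rw [coeff_mk, h, RingHom.id_apply, h', coeff_mk, map_smul]

theorem coeff_mapCoeff [CommRing A] [CommRing B] [Module R A] [Module R B] (L : A →ₗ[R] B)
    (f : A⟦X⟧) (n : ℕ) : coeff n (mapCoeff L f) = L (coeff n f) := by
  change coeff n (PowerSeries.mk fun n => L (coeff n f)) = _
  rw [coeff_mk]

/-- Coefficientwise extension of a derivation to power series. -/
noncomputable def derivationCoeff [CommRing A] [Algebra R A] (δ : Derivation R A A) :
    Derivation R A⟦X⟧ A⟦X⟧ :=
  Derivation.mk' (mapCoeff (δ : A →ₗ[R] A)) fun f g => by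
    ext n
    simp only [coeff_mapCoeff, coeff_mul, map_add, smul_eq_mul, map_sum, Derivation.coeFn_coe,
      Derivation.leibniz, Finset.sum_add_distrib]
    congr 1
    rw [← Finset.Nat.sum_antidiagonal_swap]
    rfl

theorem coeff_derivationCoeff [CommRing A] [Algebra R A] (δ : Derivation R A A) (f : A⟦X⟧) (n : ℕ) :
    coeff n (derivationCoeff δ f) = δ (coeff n f) :=
  coeff_mapCoeff (δ : A →ₗ[R] A) f n

theorem derivationCoeff_C [CommRing A] [Algebra R A] (δ : Derivation R A A) (a : A) :
    derivationCoeff δ (C a) = C (δ a) := by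
  ext n
  rw [coeff_derivationCoeff, coeff_C, coeff_C]
  split_ifs <;> simp

end Coefficientwise

section GaussianSeries

variable {ι : Type*}

/-- Inclusion of scalar power series. -/
noncomputable def scalar : ℂ⟦X⟧ →+* (MvPolynomial (ι ⊕ ι) ℂ)⟦X⟧ := PowerSeries.map MvPolynomial.C

theorem derivationCoeff_scalar (δ : Derivation ℂ (MvPolynomial (ι ⊕ ι) ℂ) (MvPolynomial (ι ⊕ ι) ℂ))
    (u : ℂ⟦X⟧) : derivationCoeff δ (scalar u) = 0 := by
  ext1 n
  rw [coeff_derivationCoeff, scalar, coeff_map, map_zero]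
  exact δ.map_algebraMap _

theorem derivative_scalar (u : ℂ⟦X⟧) :
    d⁄dX _ (scalar u : (MvPolynomial (ι ⊕ ι) ℂ)⟦X⟧) = scalar (d⁄dX ℂ u) := by
  ext1 n
  simp [scalar, coeff_derivative]

theorem constantCoeff_scalar (u : ℂ⟦X⟧) :
    constantCoeff (scalar u : (MvPolynomial (ι ⊕ ι) ℂ)⟦X⟧) = MvPolynomial.C (constantCoeff u) := by
  rw [← coeff_zero_eq_constantCoeff_apply, ← coeff_zero_eq_constantCoeff_apply, scalar, coeff_map]

theorem map_scalar (z : ι → ℂ) (u : ℂ⟦X⟧) :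
    PowerSeries.map (evalZ z : MvPolynomial (ι ⊕ ι) ℂ →+* ℂ) (scalar u) = u := by
  ext n
  rw [scalar, coeff_map, coeff_map, evalZ]
  exact MvPolynomial.aeval_C _ _

variable [Fintype ι]

/-- Coefficientwise Gaussian integral. -/
noncomputable def gaussSeries : (MvPolynomial (ι ⊕ ι) ℂ)⟦X⟧ →ₗ[ℂ] ℂ⟦X⟧ := mapCoeff gaussE

theorem gaussSeries_scalar_mul (u : ℂ⟦X⟧) (f : (MvPolynomial (ι ⊕ ι) ℂ)⟦X⟧) :
    gaussSeries (scalar u * f) = u * gaussSeries f := by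
  ext n
  simp only [gaussSeries, coeff_mapCoeff, coeff_mul, scalar, coeff_map, map_sum]
  refine Finset.sum_congr rfl fun p _ => ?_
  rw [← MvPolynomial.smul_eq_C_mul, map_smul, smul_eq_mul]

theorem derivative_gaussSeries (f : (MvPolynomial (ι ⊕ ι) ℂ)⟦X⟧) :
    d⁄dX ℂ (gaussSeries f) = gaussSeries (d⁄dX _ f) := by
  ext n
  simp only [gaussSeries, coeff_mapCoeff, coeff_derivative]
  rw [mul_comm, mul_comm (coeff (n + 1) f), ← smul_eq_mul, ← map_smul]
  congr 1
  rw [MvPolynomial.smul_eq_C_mul]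
  simp

theorem gaussSeries_X_mul (x : ι ⊕ ι) (f : (MvPolynomial (ι ⊕ ι) ℂ)⟦X⟧) :
    gaussSeries (C (MvPolynomial.X x) * f) =
      gaussSeries (derivationCoeff (MvPolynomial.pderiv x.swap) f) := by
  ext n
  simp only [gaussSeries, coeff_mapCoeff, coeff_C_mul, gaussE_X_mul, coeff_derivationCoeff]

theorem constantCoeff_gaussSeries_expSeries (W : (MvPolynomial (ι ⊕ ι) ℂ)⟦X⟧) :
    constantCoeff (gaussSeries (expSeries W)) = 1 := by
  rw [← coeff_zero_eq_constantCoeff_apply, gaussSeries, coeff_mapCoeff,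
    coeff_zero_eq_constantCoeff_apply, constantCoeff_expSeries, gaussE_one]

/-- The Gaussian integral of the exponential, coefficient by coefficient. -/
theorem coeff_gaussSeries_expSeries (W : (MvPolynomial (ι ⊕ ι) ℂ)⟦X⟧) (n : ℕ) :
    coeff n (gaussSeries (expSeries W)) = ((Real.pi : ℂ) ^ Fintype.card ι)⁻¹ *
      ∫ z : ι → ℂ, coeff n (expSeries (PowerSeries.map (evalZ z : _ →+* ℂ) W)) * gaussWeight z := by
  simp only [gaussSeries, coeff_mapCoeff, gaussE_apply, ← map_expSeries, coeff_map]
  rfl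

end GaussianSeries

/-! ### The Gaussian integral of a quadratic form as an inverse determinant. -/

section Determinant

variable {E : Type*}

/-- Entrywise derivative of a matrix of power series. -/
noncomputable def matDeriv (M : Matrix E E ℂ⟦X⟧) : Matrix E E ℂ⟦X⟧ := M.map (d⁄dX ℂ)

theorem matDeriv_one [DecidableEq E] : matDeriv (1 : Matrix E E ℂ⟦X⟧) = 0 := by
  ext1 i j
  by_cases h : i = j <;> simp [matDeriv, h]

variable [Fintype E]

theorem matDeriv_mul (M P : Matrix E E ℂ⟦X⟧) :
    matDeriv (M * P) = matDeriv M * P + M * matDeriv P := by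
  ext1 i j
  simp only [matDeriv, Matrix.map_apply, Matrix.mul_apply, Matrix.add_apply, map_sum,
    Derivation.leibniz, smul_eq_mul, Finset.sum_add_distrib]
  rw [add_comm]
  congr 1
  exact Finset.sum_congr rfl fun _ _ => mul_comm _ _

theorem derivative_trace (M : Matrix E E ℂ⟦X⟧) :
    d⁄dX ℂ M.trace = (matDeriv M).trace := by
  simp [Matrix.trace, matDeriv, map_sum]

/-- The quadratic form `T̄ M T`. -/
noncomputable def quadraticForm (M : Matrix E E ℂ⟦X⟧) : (MvPolynomial (E ⊕ E) ℂ)⟦X⟧ :=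
  ∑ a, ∑ b, scalar (M a b) * (C (MvPolynomial.X (Sum.inr a)) * C (MvPolynomial.X (Sum.inl b)))

theorem constantCoeff_quadraticForm {M : Matrix E E ℂ⟦X⟧}
    (hM : ∀ a b, constantCoeff (M a b) = 0) : constantCoeff (quadraticForm M) = 0 := by
  simp [quadraticForm, map_sum, constantCoeff_scalar, hM]

theorem derivationCoeff_quadraticForm [DecidableEq E] (M : Matrix E E ℂ⟦X⟧) (a : E) :
    derivationCoeff (MvPolynomial.pderiv (Sum.inl a)) (quadraticForm M) =
      ∑ c, scalar (M c a) * C (MvPolynomial.X (Sum.inr c)) := by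
  simp only [quadraticForm, map_sum, Derivation.leibniz, derivationCoeff_scalar,
    derivationCoeff_C, MvPolynomial.pderiv_X, smul_eq_mul, mul_zero, add_zero]
  refine Finset.sum_congr rfl fun c _ => ?_
  rw [Finset.sum_eq_single a]
  · simp
  · intro b _ hb
    simp [hb]
  · simp

theorem derivative_quadraticForm (M : Matrix E E ℂ⟦X⟧) :
    d⁄dX _ (quadraticForm M) = quadraticForm (matDeriv M) := by
  simp only [quadraticForm, map_sum, Derivation.leibniz, derivative_scalar, derivative_C, matDeriv,
    Matrix.map_apply, smul_eq_mul, mul_zero, add_zero, zero_add]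
  refine Finset.sum_congr rfl fun a _ => Finset.sum_congr rfl fun b _ => mul_comm _ _

variable [DecidableEq E]

/-- `M` need not commute with its derivative, but the trace is cyclic. The extra factor `M ^ k`
makes the induction close; for `m = 0` the truncated `m - 1` is harmless because of the factor `m`.
-/
theorem trace_matDeriv_pow_mul (M : Matrix E E ℂ⟦X⟧) (m k : ℕ) :
    (matDeriv (M ^ m) * M ^ k).trace = (m : ℂ⟦X⟧) * (matDeriv M * M ^ (m - 1 + k)).trace := by
  induction m generalizing k with
  | zero => simp [matDeriv_one]
  | succ m ih =>
    rw [pow_succ, matDeriv_mul, add_mul, Matrix.trace_add, mul_assoc, ← pow_succ', ih, mul_assoc,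
      Matrix.trace_mul_comm (M ^ m), mul_assoc, ← pow_add, Nat.add_sub_cancel, add_comm k m]
    rcases m with _ | m
    · simp
    · rw [Nat.add_sub_cancel, show m + 1 + k = m + (k + 1) by ring]
      push_cast
      ring

theorem derivative_trace_pow (M : Matrix E E ℂ⟦X⟧) (m : ℕ) :
    d⁄dX ℂ (M ^ m).trace = (m : ℂ⟦X⟧) * (matDeriv M * M ^ (m - 1)).trace := by
  have := trace_matDeriv_pow_mul M m 0
  rwa [pow_zero, mul_one, add_zero, ← derivative_trace] at this

theorem X_pow_dvd_matrix_pow {M : Matrix E E ℂ⟦X⟧} (hM : ∀ a b, constantCoeff (M a b) = 0)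
    (m : ℕ) (a b : E) : X ^ m ∣ (M ^ m) a b := by
  induction m generalizing a b with
  | zero => simp
  | succ m ih =>
    rw [pow_succ, pow_succ, Matrix.mul_apply]
    exact Finset.dvd_sum fun c _ => mul_dvd_mul (ih a c) (X_dvd_iff.2 (hM c b))

theorem coeff_trace_pow_eq_zero {M : Matrix E E ℂ⟦X⟧} (hM : ∀ a b, constantCoeff (M a b) = 0)
    (P : Matrix E E ℂ⟦X⟧) {n m : ℕ} (h : n < m) : coeff n (P * M ^ m).trace = 0 := by
  refine X_pow_dvd_iff.1 ?_ n h
  simp only [Matrix.trace, Matrix.diag_apply, Matrix.mul_apply]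
  exact Finset.dvd_sum fun a _ => Finset.dvd_sum fun b _ =>
    Dvd.dvd.mul_left (X_pow_dvd_matrix_pow hM m b a) _

theorem coeff_trace_matLog (M : Matrix E E ℂ⟦X⟧) (n : ℕ) :
    coeff n (matLog (1 - M)).trace = -∑ m ∈ Finset.Icc 1 n, coeff n (M ^ m).trace / (m : ℂ) := by
  simp only [matLog, Matrix.trace, Matrix.diag_apply, Matrix.of_apply, map_sum, coeff_mk,
    sub_sub_cancel, Finset.sum_neg_distrib]
  rw [Finset.sum_comm]
  simp only [Finset.sum_div]

theorem constantCoeff_trace_matLog (M : Matrix E E ℂ⟦X⟧) :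
    constantCoeff (matLog (1 - M)).trace = 0 := by
  rw [← coeff_zero_eq_constantCoeff_apply, coeff_trace_matLog]
  simp

/-- The logarithmic derivative of the determinant, order by order. -/
theorem coeff_derivative_trace_matLog {M : Matrix E E ℂ⟦X⟧}
    (hM : ∀ a b, constantCoeff (M a b) = 0) {n K : ℕ} (hn : n < K) :
    coeff n (d⁄dX ℂ (-(matLog (1 - M)).trace)) =
      coeff n (∑ m ∈ Finset.range K, (matDeriv M * M ^ m).trace) := by
  have h1 : coeff n (d⁄dX ℂ (-(matLog (1 - M)).trace)) =
      coeff n (∑ m ∈ Finset.range (n + 1), (matDeriv M * M ^ m).trace) := by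
    rw [coeff_derivative, map_neg, coeff_trace_matLog, neg_neg, Finset.sum_mul, map_sum,
      ← Finset.Ico_succ_right_eq_Icc, Finset.sum_Ico_eq_sum_range]
    refine Finset.sum_congr rfl fun m _ => ?_
    have h := congrArg (coeff n) (derivative_trace_pow M (1 + m))
    rw [coeff_derivative, ← map_natCast (C (R := ℂ)), coeff_C_mul, Nat.add_sub_cancel_left] at h
    have h0 : ((1 + m : ℕ) : ℂ) ≠ 0 := by exact_mod_cast (by omega : 1 + m ≠ 0)
    field_simp
    linear_combination h
  rw [h1, map_sum, map_sum]
  refine Finset.sum_subset (Finset.range_mono (by omega)) fun m _ hm => ?_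
  exact coeff_trace_pow_eq_zero hM _ (by simpa using hm)

/-- The Gaussian integral of `exp (T̄ M T)` is the inverse of the determinant of `1 - M`. -/
theorem gaussSeries_expSeries_quadraticForm {M : Matrix E E ℂ⟦X⟧}
    (hM : ∀ a b, constantCoeff (M a b) = 0) :
    gaussSeries (expSeries (quadraticForm M)) = expSeries (-(matLog (1 - M)).trace) := by
  have hW := constantCoeff_quadraticForm hM
  set W := quadraticForm M with hWdef
  set F := gaussSeries (expSeries W) with hF
  -- `H` is the two-point function: its entry at `(b, a)` is the expectation of `T̄_a T_b exp W`.
  set H : Matrix E E ℂ⟦X⟧ := Matrix.of fun b a =>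
    gaussSeries (C (MvPolynomial.X (Sum.inr a)) * (C (MvPolynomial.X (Sum.inl b)) * expSeries W))
    with hH
  -- Schwinger–Dyson equation: integrating `T̄_a` by parts differentiates in `T_a`, which hits
  -- either `T_b`, giving the diagonal term, or the exponential, giving `H * M`.
  have hrec : H = F • (1 : Matrix E E ℂ⟦X⟧) + H * M := by
    ext1 b a
    rw [Matrix.add_apply, Matrix.mul_apply, hH, Matrix.of_apply, gaussSeries_X_mul, Sum.swap_inr,
      Derivation.leibniz, derivation_expSeries _ hW, hWdef, derivationCoeff_quadraticForm, ← hWdef,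
      derivationCoeff_C, MvPolynomial.pderiv_X, map_add, add_comm]
    congr 1
    · by_cases h : a = b
      · subst h
        simp [hF]
      · simp [Ne.symm h]
    · rw [smul_eq_mul, Finset.mul_sum, Finset.mul_sum, map_sum]
      refine Finset.sum_congr rfl fun c _ => ?_
      rw [Matrix.of_apply, mul_comm (gaussSeries _), ← gaussSeries_scalar_mul]
      refine congrArg gaussSeries ?_
      ring
  -- Iteration gives the geometric series for `H`. The remainder `H * M ^ K` has order at least `K`
  -- in `X`, so no inverse of `1 - M` is needed.
  have hiter : ∀ K, H = F • ∑ m ∈ Finset.range K, M ^ m + H * M ^ K := by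
    intro K
    induction K with
    | zero => simp
    | succ K ih =>
      conv_lhs => rw [ih]
      rw [Finset.sum_range_succ, smul_add, add_assoc]
      congr 1
      conv_lhs => rw [hrec]
      rw [add_mul, smul_mul_assoc, one_mul, mul_assoc, ← pow_succ']
  have hDF : d⁄dX ℂ F = (matDeriv M * H).trace := by
    rw [hF, derivative_gaussSeries]
    have hD := derivation_expSeries
      ((d⁄dX (MvPolynomial (E ⊕ E) ℂ)).restrictScalars ℂ) hW
    rw [Derivation.restrictScalars_apply, Derivation.restrictScalars_apply, hWdef,
      derivative_quadraticForm, ← hWdef] at hD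
    rw [hD, quadraticForm]
    simp only [Finset.mul_sum, map_sum, Matrix.trace, Matrix.diag_apply, Matrix.mul_apply]
    refine Finset.sum_congr rfl fun a _ => Finset.sum_congr rfl fun b _ => ?_
    rw [hH, Matrix.of_apply, ← gaussSeries_scalar_mul]
    refine congrArg gaussSeries ?_
    ring
  have hL : constantCoeff (-(matLog (1 - M)).trace) = 0 := by
    rw [map_neg, constantCoeff_trace_matLog, neg_zero]
  refine eq_of_derivative_eq_mul (u := d⁄dX ℂ (-(matLog (1 - M)).trace)) ?_
    (derivative_expSeries hL) ?_
  -- At order `n` the remainder drops out, and what is left of `tr (M' H)` is `F` times the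
  -- derivative of `-tr ln (1 - M)`.
  · ext n
    have h1 : d⁄dX ℂ F = F * ∑ m ∈ Finset.range (n + 1), (matDeriv M * M ^ m).trace
        + (matDeriv M * H * M ^ (n + 1)).trace := by
      rw [hDF]
      conv_lhs => rw [hiter (n + 1)]
      rw [mul_add, Matrix.trace_add, mul_smul_comm, Matrix.trace_smul, smul_eq_mul,
        Finset.mul_sum, Matrix.trace_sum, ← mul_assoc]
    rw [h1, map_add, coeff_trace_pow_eq_zero hM _ (Nat.lt_succ_self n), add_zero, coeff_mul,
      coeff_mul]
    refine Finset.sum_congr rfl fun p hp => ?_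
    rw [coeff_derivative_trace_matLog hM (K := n + 1)]
    have := Finset.HasAntidiagonal.mem_antidiagonal.1 hp
    omega
  · rw [constantCoeff_gaussSeries_expSeries, constantCoeff_expSeries]

end Determinant

/-! ### Rooted plane trees and walks along their contour. -/

namespace PlaneTree

variable {d : ℕ}

/-- A choice of root, with the distance to the root and the half-edge that starts the path from a
vertex to the root. -/
structure Rooting (S : PlaneTree d) (r : S.Vert) where
  depth : S.Vert → ℕ
  parent : S.Vert → S.Half
  parent_fst : ∀ v, v ≠ r → (parent v).1 = v
  depth_parent : ∀ v, v ≠ r → depth (S.twin (parent v)).1 + 1 = depth v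
  dichotomy : ∀ h : S.Half, (h.1 ≠ r ∧ h = parent h.1) ∨
    ((S.twin h).1 ≠ r ∧ S.twin h = parent (S.twin h).1)

/-- Parents are taken along geodesics to `r`. The half-edges towards parents and their twins are all
distinct, and there are `2 (|Vert| - 1)` of them, which by `card_vert` is the number of half-edges.
Hence every edge joins a vertex to its parent. -/
theorem nonempty_rooting (S : PlaneTree d) [Nonempty S.Half] (r : S.Vert) : Nonempty (S.Rooting r) := by
  classical
  set G := SimpleGraph.fromRel fun v w => ∃ h : S.Half, h.1 = v ∧ (S.twin h).1 = w with hG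
  have key : ∀ v, ∃ h : S.Half, v ≠ r → h.1 = v ∧ G.dist (S.twin h).1 r + 1 = G.dist v r := by
    intro v
    by_cases hv : v = r
    · exact ⟨Classical.arbitrary _, fun h => absurd hv h⟩
    · obtain ⟨w, hw⟩ := S.connected.exists_walk_length_eq_dist v r
      cases w with
      | nil => exact absurd rfl hv
      | @cons _ u _ hadj q =>
        rw [SimpleGraph.fromRel_adj] at hadj
        have hd : ∀ h : S.Half, h.1 = v → (S.twin h).1 = u → 
            G.dist (S.twin h).1 r + 1 = G.dist v r := by
          intro h h1 h2
          have h3 : G.dist u r ≤ q.length := SimpleGraph.dist_le q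
          have h4 : G.Adj v u := by
            rw [hG, SimpleGraph.fromRel_adj]
            exact hadj
          have h5 : G.dist v r ≤ G.dist v u + G.dist u r := S.connected.dist_triangle
          rw [SimpleGraph.dist_eq_one_iff_adj.2 h4] at h5
          have h6 : q.length + 1 = G.dist v r := hw
          rw [h2]
          omega
        rcases hadj.2 with ⟨h, h1, h2⟩ | ⟨h, h1, h2⟩
        · exact ⟨h, fun _ => ⟨h1, hd h h1 h2⟩⟩
        · exact ⟨S.twin h, fun _ => ⟨h2, hd _ h2 (by rw [S.twin_twin, h1])⟩⟩
  choose p hp using key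
  let Φ : {v // v ≠ r} ⊕ {v // v ≠ r} → S.Half :=
    Sum.elim (fun v => p v) fun v => S.twin (p v)
  have hinj : Function.Injective Φ := by
    have hpp : ∀ v w : {v // v ≠ r}, p v = p w → v = w := by
      intro v w h
      apply Subtype.ext
      rw [← (hp v v.2).1, h, (hp w w.2).1]
    -- If the parent half-edges of `v` and `w` were twins, each vertex would be one step closer to
    -- the root than the other.
    have hpt : ∀ v w : {v // v ≠ r}, p v ≠ S.twin (p w) := by
      intro v w h
      have h1 := (hp v v.2).2
      have h2 := (hp w w.2).2
      rw [h, S.twin_twin, (hp w w.2).1] at h1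
      rw [← h, (hp v v.2).1] at h2
      omega
    rintro (v | v) (w | w) h
    · exact congrArg _ (hpp v w h)
    · exact absurd h (hpt v w)
    · exact absurd h.symm (hpt w v)
    · refine congrArg _ (hpp v w ?_)
      have := congrArg S.twin h
      simpa only [Φ, Sum.elim_inr, S.twin_twin] using this
  have hcard : Fintype.card ({v // v ≠ r} ⊕ {v // v ≠ r}) = Fintype.card S.Half := by
    have : 2 * Fintype.card S.Vert = Fintype.card S.Half + 2 := S.card_vert
    have h1 : Fintype.card {v // v ≠ r} = Fintype.card S.Vert - 1 := by
      rw [Fintype.card_subtype_compl, Fintype.card_subtype_eq]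
    rw [Fintype.card_sum, h1]
    omega
  have hsurj := ((Fintype.bijective_iff_injective_and_card Φ).2 ⟨hinj, hcard⟩).2
  refine ⟨⟨fun v => G.dist v r, p, fun v hv => (hp v hv).1, fun v hv => (hp v hv).2,
    fun h => ?_⟩⟩
  obtain ⟨v | v, rfl⟩ := hsurj h
  · left
    simp only [Φ, Sum.elim_inl, (hp v v.2).1]
    exact ⟨v.2, trivial⟩
  · right
    simp only [Φ, Sum.elim_inr, S.twin_twin, (hp v v.2).1]
    exact ⟨v.2, trivial⟩

variable {S : PlaneTree d}

/-- Following the edges of color `c` and the dashed lines backwards never loops: the contour of a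
subtree of a plane tree meets every marked corner of the subtree. -/
theorem wellFounded_dash_edge (S : PlaneTree d) (c : Fin d) :
    WellFounded fun h' h : S.Half => S.toGraph.dash h (S.toGraph.edge c h') := by
  set R := fun h' h : S.Half => S.toGraph.dash h (S.toGraph.edge c h') with hR
  refine ⟨fun h₀ => ?_⟩
  obtain ⟨r⟩ : Nonempty S.Vert := S.connected.nonempty
  have : Nonempty S.Half := ⟨h₀⟩
  obtain ⟨ρ⟩ := S.nonempty_rooting r
  -- One step of the walk goes to the half-edge `k` after `h`, and crosses the edge of `k` exactly
  -- when `c` is one of its colors.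
  have hstep : ∀ h' h, R h' h → ∃ k : S.Half, h.1 = k.1 ∧ (h.2 : ℕ) + 1 = k.2 ∧
      (h' = k ∨ h' = S.twin k) := by
    intro h' h hh
    refine ⟨S.toGraph.edge c h', hh.1, hh.2, ?_⟩
    change h' = (if c ∈ S.color h' then S.twin h' else h') ∨
      h' = S.twin (if c ∈ S.color h' then S.twin h' else h')
    split_ifs
    · exact Or.inr (S.twin_twin h').symm
    · exact Or.inl rfl
  have hdepth : ∀ v, ρ.depth v ≤ ∑ v, ρ.depth v := fun v =>
    Finset.single_le_sum (fun _ _ => Nat.zero_le _) (Finset.mem_univ v)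
  -- From a position at or after the parent half-edge, the walk can no longer cross the parent edge:
  -- it advances around its vertex or enters a child, where it lands on the parent half-edge of that
  -- child. The measures are the codepth, with the sum of all depths as an upper bound for the
  -- depth, and then the number of half-edges left.
  have below : ∀ n, ∀ h : S.Half, (∑ v, ρ.depth v) - ρ.depth h.1 = n → h.1 ≠ r →
      ((ρ.parent h.1).2 : ℕ) ≤ h.2 → Acc R h := by
    intro n
    induction n using Nat.strong_induction_on with
    | _ n ihn =>
      intro h hn hr hp
      induction hm : S.deg h.1 - h.2 using Nat.strong_induction_on generalizing h with
      | _ m ihm =>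
        refine Acc.intro _ fun h' hh' => ?_
        obtain ⟨k, hk1, hk2, hk⟩ := hstep h' h hh'
        have hlt := k.2.2
        have hdeg : S.deg k.1 = S.deg h.1 := by rw [hk1]
        rcases hk with rfl | rfl
        · have hpar : ((ρ.parent h'.1).2 : ℕ) = (ρ.parent h.1).2 := by rw [hk1]
          exact ihm _ (by omega) h' (by rw [← hk1, hn]) (by rwa [← hk1]) (by omega) rfl
        · rcases ρ.dichotomy k with ⟨_, hk3⟩ | ⟨hk3, hk4⟩
          · have : ((ρ.parent h.1).2 : ℕ) = k.2 := by rw [hk1, ← hk3]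
            omega
          · have hd := ρ.depth_parent _ hk3
            rw [← hk4, S.twin_twin, ← hk1] at hd
            have := hdepth (S.twin k).1
            exact ihn _ (by omega) (S.twin k) rfl hk3 (by rw [← hk4])
  -- From any position the walk advances, or climbs to the parent, which lowers the depth, or enters
  -- a child, where `below` applies.
  have all : ∀ n, ∀ h : S.Half, ρ.depth h.1 = n → Acc R h := by
    intro n
    induction n using Nat.strong_induction_on with
    | _ n ihn =>
      intro h hn
      induction hm : S.deg h.1 - h.2 using Nat.strong_induction_on generalizing h with
      | _ m ihm =>
        refine Acc.intro _ fun h' hh' => ?_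
        obtain ⟨k, hk1, hk2, hk⟩ := hstep h' h hh'
        have hlt := k.2.2
        have hdeg : S.deg k.1 = S.deg h.1 := by rw [hk1]
        rcases hk with rfl | rfl
        · exact ihm _ (by omega) h' (by rw [← hk1, hn]) rfl
        · rcases ρ.dichotomy k with ⟨hk3, hk4⟩ | ⟨hk3, hk4⟩
          · have hd := ρ.depth_parent _ hk3
            rw [← hk4, ← hk1] at hd
            exact ihn _ (by omega) _ rfl
          · exact below _ (S.twin k) rfl hk3 (by rw [← hk4])
  exact all _ h₀ rfl

/-- The vertex count gives at least two vertices once there is a half-edge, so `v` is not the root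
for a suitable choice and carries its own parent half-edge. -/
theorem deg_pos (S : PlaneTree d) [Nonempty S.Half] (v : S.Vert) : 0 < S.deg v := by
  obtain ⟨r, hr⟩ : ∃ r, r ≠ v := by
    by_contra! h
    have : Fintype.card S.Vert ≤ 1 := Fintype.card_le_one_iff.2 fun a b => by rw [h a, h b]
    have : 2 * Fintype.card S.Vert = Fintype.card S.Half + 2 := S.card_vert
    have := Fintype.card_pos (α := S.Half)
    omega
  obtain ⟨ρ⟩ := S.nonempty_rooting r
  have := (ρ.parent v).2.pos
  rwa [ρ.parent_fst v hr.symm] at this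

end PlaneTree

/-! ### Gaussian integration over the edges of a tree. -/

namespace PlaneTree

variable {d : ℕ}

/-- The depth changes by one along every edge, so there are no loops. -/
theorem Rooting.twin_fst_ne {S : PlaneTree d} {r : S.Vert} (ρ : S.Rooting r) (h : S.Half) :
    (S.twin h).1 ≠ h.1 := by
  intro he
  rcases ρ.dichotomy h with ⟨h1, h2⟩ | ⟨h1, h2⟩
  · have := ρ.depth_parent _ h1
    rw [← h2, he] at this
    omega
  · have := ρ.depth_parent _ h1
    rw [← h2, S.twin_twin, he] at this
    omega

open Classical in
/-- Gaussian random fields `x h a`, one for each half-edge `h`, where `x h a` and `x h' b` are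
uncorrelated unless `h'` is the other half of `h`, and then have covariance `0` or `1`. The
derivation `δ h a` is the one that appears when `x h a` is integrated by parts. -/
structure HalfEdgeField (S : PlaneTree d) (ι A : Type*) [Fintype ι] where
  x : S.Half → A → MvPolynomial (ι ⊕ ι) ℂ
  δ : S.Half → A → Derivation ℂ (MvPolynomial (ι ⊕ ι) ℂ) (MvPolynomial (ι ⊕ ι) ℂ)
  pairing : S.Half → A → A → Prop
  pairing_twin : ∀ h a b, pairing (S.twin h) b a ↔ pairing h a b
  gaussE_mul : ∀ h a p, gaussE (x h a * p) = gaussE (δ h a p)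
  δ_twin : ∀ h a b, δ h a (x (S.twin h) b) = if pairing h a b then 1 else 0
  δ_ne : ∀ h a h' b, h' ≠ S.twin h → δ h a (x h' b) = 0

namespace HalfEdgeField

variable {S : PlaneTree d} {ι A : Type*} [Fintype ι] [Fintype A] (Ξ : S.HalfEdgeField ι A)
  (coef : ∀ v : S.Vert, (Fin (S.deg v) → A) → ℂ) (u : S.Vert → ℂ⟦X⟧)

/-- The polynomial of a vertex, a linear combination of the products of the fields on the
half-edges of the vertex. -/
noncomputable def vertexPoly (v : S.Vert) : MvPolynomial (ι ⊕ ι) ℂ :=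
  ∑ J : Fin (S.deg v) → A, MvPolynomial.C (coef v J) * ∏ i, Ξ.x ⟨v, i⟩ (J i)

/-- The interaction, a sum over the vertices of the tree. -/
noncomputable def interaction : (MvPolynomial (ι ⊕ ι) ℂ)⟦X⟧ :=
  ∑ v, scalar (u v) * C (Ξ.vertexPoly coef v)

/-- The assignments of indices to half-edges that are compatible with the covariance on the edges
between two vertices of `U`. -/
def Compatible (U : Finset S.Vert) (I : ∀ v : S.Vert, Fin (S.deg v) → A) : Prop :=
  ∀ h : S.Half, h.1 ∈ U → (S.twin h).1 ∈ U →
    Ξ.pairing h (I h.1 h.2) (I (S.twin h).1 (S.twin h).2)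

open Classical in
/-- The half-edges that leave a set of vertices. -/
noncomputable def _root_.GMModel.PlaneTree.boundary (S : PlaneTree d) (U : Finset S.Vert) :
    Finset S.Half :=
  Finset.univ.filter fun h => h.1 ∈ U ∧ (S.twin h).1 ∉ U

open Classical in
/-- The product of the vertex terms of `U`, where the edges between vertices of `U` have been
integrated out. -/
noncomputable def contracted (U : Finset S.Vert) (I : ∀ v : S.Vert, Fin (S.deg v) → A) :
    MvPolynomial (ι ⊕ ι) ℂ :=
  MvPolynomial.C ((∏ v ∈ U, coef v (I v)) * if Ξ.Compatible U I then 1 else 0) *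
    ∏ h ∈ S.boundary U, Ξ.x h (I h.1 h.2)

open Classical in
/-- The full contraction of the vertex terms. -/
noncomputable def fullContraction : ℂ :=
  ∑ I : ∀ v : S.Vert, Fin (S.deg v) → A,
    if Ξ.Compatible Finset.univ I then ∏ v, coef v (I v) else 0

omit [Fintype A] in
theorem gaussSeries_mul (h : S.Half) (a : A) (f : (MvPolynomial (ι ⊕ ι) ℂ)⟦X⟧) :
    gaussSeries (C (Ξ.x h a) * f) = gaussSeries (derivationCoeff (Ξ.δ h a) f) := by
  ext n
  simp only [gaussSeries, coeff_mapCoeff, coeff_C_mul, Ξ.gaussE_mul, coeff_derivationCoeff]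

theorem constantCoeff_interaction (hu : ∀ v, constantCoeff (u v) = 0) :
    constantCoeff (Ξ.interaction coef u) = 0 := by
  simp [interaction, map_sum, constantCoeff_scalar, hu]

omit [Fintype A] in
theorem δ_prod_eq_zero (h : S.Half) (a : A) (s : Finset S.Half) (hs : S.twin h ∉ s)
    (b : S.Half → A) : Ξ.δ h a (∏ h' ∈ s, Ξ.x h' (b h')) = 0 := by
  classical
  induction s using Finset.induction_on with
  | empty => simp
  | insert k s hk ih =>
    rw [Finset.mem_insert, not_or] at hs
    rw [Finset.prod_insert hk, Derivation.leibniz, ih hs.2, Ξ.δ_ne _ _ _ _ (Ne.symm hs.1)]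
    simp

-- The indices at `v` are written as an update of a global assignment `I`, so that the fields at `v`
-- merge with those already present in `contracted`.
open Classical in
theorem vertexPoly_eq (v : S.Vert) (I : ∀ v : S.Vert, Fin (S.deg v) → A) :
    Ξ.vertexPoly coef v = ∑ J : Fin (S.deg v) → A, MvPolynomial.C (coef v J) *
      ∏ h ∈ Finset.univ.filter (fun h : S.Half => h.1 = v),
        Ξ.x h (Function.update I v J h.1 h.2) := by
  refine Finset.sum_congr rfl fun J _ => ?_
  congr 1
  have : Finset.univ.filter (fun h : S.Half => h.1 = v) =
      Finset.univ.map ⟨Sigma.mk v, sigma_mk_injective⟩ := by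
    ext ⟨w, i⟩
    simp only [Finset.mem_filter, Finset.mem_univ, true_and, Finset.mem_map,
      Function.Embedding.coeFn_mk]
    constructor
    · rintro rfl
      exact ⟨i, rfl⟩
    · rintro ⟨j, hj⟩
      exact (congrArg Sigma.fst hj).symm
  rw [this, Finset.prod_map]
  simp

-- Overwriting the value at `v` forgets `I v`, hence the multiplicity. It is needed because
-- `contracted` depends only on the indices in `U` while the sums run over all assignments.
open Classical in
theorem sum_sum_update {M : Type*} [AddCommMonoid M] (v : S.Vert)
    (f : (∀ v : S.Vert, Fin (S.deg v) → A) → M) :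
    ∑ I : ∀ v : S.Vert, Fin (S.deg v) → A, ∑ J : Fin (S.deg v) → A, f (Function.update I v J) =
      Fintype.card (Fin (S.deg v) → A) • ∑ I, f I := by
  -- Keeping the overwritten value as second component turns the update into an involution, hence a
  -- bijection.
  let e : (∀ v : S.Vert, Fin (S.deg v) → A) × (Fin (S.deg v) → A) →
      (∀ v : S.Vert, Fin (S.deg v) → A) × (Fin (S.deg v) → A) :=
    fun p => (Function.update p.1 v p.2, p.1 v)
  have he : Function.Involutive e := by
    rintro ⟨I, J⟩
    simp [e]
  rw [← Fintype.sum_prod_type' (f := fun I J => f (Function.update I v J)),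
    Fintype.sum_bijective e he.bijective _ (fun p => f p.1) (fun p => rfl),
    Fintype.sum_prod_type_right]
  simp

open Classical in
/-- Integration by parts of the half-edge that joins `U` to a new vertex `v`. -/
theorem gaussSeries_contracted {r : S.Vert} (ρ : S.Rooting r) {U : Finset S.Vert} {v : S.Vert}
    (hvr : v ≠ r) (hvU : v ∉ U) (hp : (S.twin (ρ.parent v)).1 ∈ U)
    (huniq : ∀ h : S.Half, h.1 = v → (S.twin h).1 ∈ U → h = ρ.parent v)
    (hu : ∀ v, constantCoeff (u v) = 0) (I : ∀ v : S.Vert, Fin (S.deg v) → A) :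
    gaussSeries (C (Ξ.contracted coef U I) * expSeries (Ξ.interaction coef u)) =
      u v * ∑ J : Fin (S.deg v) → A,
        gaussSeries (C (Ξ.contracted coef (insert v U) (Function.update I v J)) *
          expSeries (Ξ.interaction coef u)) := by
  have hpv := ρ.parent_fst v hvr
  set p := ρ.parent v with hpdef
  set q := S.twin p with hq
  set at_v := Finset.univ.filter (fun h : S.Half => h.1 = v) with hat
  have hqp : S.twin q = p := S.twin_twin p
  have hqb : q ∈ S.boundary U := by
    simp only [boundary, Finset.mem_filter, Finset.mem_univ, true_and, hqp, hpv]
    exact ⟨hp, hvU⟩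
  have hpat : p ∈ at_v := by simp [hat, hpv]
  have hold : ∀ (J : Fin (S.deg v) → A) (h : S.Half), h.1 ∈ U →
      Function.update I v J h.1 h.2 = I h.1 h.2 := by
    intro J h hh
    rw [Function.update_of_ne]
    rintro rfl
    exact hvU hh
  -- As `p` is the only edge from `v` to `U`, absorbing `v` removes `q` from the boundary and adds
  -- the half-edges at `v` other than `p`.
  have hbd : S.boundary (insert v U) = (S.boundary U).erase q ∪ at_v.erase p := by
    ext h
    simp only [boundary, hat, Finset.mem_filter, Finset.mem_univ, true_and, Finset.mem_insert,
      Finset.mem_union, Finset.mem_erase, not_or]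
    constructor
    · rintro ⟨h1 | h1, h2, h3⟩
      · refine Or.inr ⟨?_, h1⟩
        rintro rfl
        exact h3 hp
      · refine Or.inl ⟨?_, h1, h3⟩
        rintro rfl
        exact h2 (by rw [hqp, hpv])
    · rintro (⟨h1, h2, h3⟩ | ⟨h1, h2⟩)
      · refine ⟨Or.inr h2, fun h4 => h1 ?_, h3⟩
        rw [hq, ← huniq (S.twin h) h4 (by rwa [S.twin_twin]), S.twin_twin]
      · exact ⟨Or.inl h2, fun h3 => ρ.twin_fst_ne h (h3.trans h2.symm),
          fun h3 => h1 (huniq h h2 h3)⟩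
  have hdisj : Disjoint ((S.boundary U).erase q) (at_v.erase p) := by
    rw [Finset.disjoint_left]
    intro h h1 h2
    have h3 := (Finset.mem_filter.1 (Finset.mem_of_mem_erase h1)).2.1
    have h4 := (Finset.mem_filter.1 (Finset.mem_of_mem_erase h2)).2
    exact hvU (h4 ▸ h3)
  have hcompat : ∀ J : Fin (S.deg v) → A, Ξ.Compatible (insert v U) (Function.update I v J) ↔
      Ξ.Compatible U I ∧ Ξ.pairing q (I q.1 q.2) (Function.update I v J p.1 p.2) := by
    intro J
    constructor
    · intro hc
      refine ⟨fun h h1 h2 => ?_, ?_⟩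
      · have := hc h (Finset.mem_insert_of_mem h1) (Finset.mem_insert_of_mem h2)
        rwa [hold J h h1, hold J _ h2] at this
      · have := hc q (Finset.mem_insert_of_mem hp) (by rw [hqp, hpv]; exact Finset.mem_insert_self _ _)
        rwa [hold J q hp, hqp] at this
    · rintro ⟨hc, hc'⟩ h h1 h2
      rcases Finset.mem_insert.1 h1 with h1 | h1 <;> rcases Finset.mem_insert.1 h2 with h2 | h2
      · exact absurd (h2.trans h1.symm) (ρ.twin_fst_ne h)
      · have h3 := huniq h h1 h2
        subst h3
        rw [← hq, hold J q hp]
        exact (Ξ.pairing_twin p _ _).1 hc'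
      · have h3 : h = q := by
          rw [← S.twin_twin h, huniq (S.twin h) h2 (by rwa [S.twin_twin])]
        rw [h3, hqp, hold J q hp]
        exact hc'
      · rw [hold J h h1, hold J _ h2]
        exact hc h h1 h2
  -- The field of `q` is correlated only with that of `p`, so its derivation kills every vertex
  -- polynomial except that of `v`.
  have hδW : derivationCoeff (Ξ.δ q (I q.1 q.2)) (Ξ.interaction coef u) =
      scalar (u v) * C (Ξ.δ q (I q.1 q.2) (Ξ.vertexPoly coef v)) := by
    rw [interaction, map_sum, Finset.sum_eq_single v]
    · rw [Derivation.leibniz, derivationCoeff_scalar, derivationCoeff_C, smul_zero, add_zero,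
        smul_eq_mul]
    · intro w _ hw
      rw [Derivation.leibniz, derivationCoeff_scalar, derivationCoeff_C, smul_zero, add_zero,
        smul_eq_mul, Ξ.vertexPoly_eq coef w I, map_sum, Finset.sum_eq_zero, map_zero, mul_zero]
      intro J _
      rw [Derivation.leibniz, Ξ.δ_prod_eq_zero, ← MvPolynomial.algebraMap_eq,
        Derivation.map_algebraMap]
      · simp
      · rw [hqp, Finset.mem_filter, hpv]
        exact fun h => hw h.2.symm
    · simp
  have hδP : Ξ.δ q (I q.1 q.2) (Ξ.vertexPoly coef v) =
      ∑ J : Fin (S.deg v) → A, MvPolynomial.C (coef v J *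
        if Ξ.pairing q (I q.1 q.2) (Function.update I v J p.1 p.2) then 1 else 0) *
        ∏ h ∈ at_v.erase p, Ξ.x h (Function.update I v J h.1 h.2) := by
    rw [Ξ.vertexPoly_eq coef v I, map_sum]
    refine Finset.sum_congr rfl fun J _ => ?_
    rw [← hat, ← Finset.mul_prod_erase _ _ hpat, Derivation.leibniz, Derivation.leibniz,
      Ξ.δ_prod_eq_zero _ _ _ (by rw [hqp]; exact Finset.notMem_erase _ _)
        (fun h => Function.update I v J h.1 h.2),
      ← MvPolynomial.algebraMap_eq, Derivation.map_algebraMap, smul_zero, smul_zero, add_zero,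
      zero_add, ← hqp, Ξ.δ_twin, hqp]
    simp only [smul_eq_mul, map_mul]
    split_ifs <;> simp
  have hI : Ξ.contracted coef U I = Ξ.x q (I q.1 q.2) *
      (MvPolynomial.C ((∏ v ∈ U, coef v (I v)) * if Ξ.Compatible U I then 1 else 0) *
        ∏ h ∈ (S.boundary U).erase q, Ξ.x h (I h.1 h.2)) := by
    rw [contracted, ← Finset.mul_prod_erase _ _ hqb]
    ring
  -- The twin `p` is not in the boundary of `U`, so the remaining prefactor is not differentiated.
  have hrest : Ξ.δ q (I q.1 q.2)
      (MvPolynomial.C ((∏ v ∈ U, coef v (I v)) * if Ξ.Compatible U I then 1 else 0) *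
        ∏ h ∈ (S.boundary U).erase q, Ξ.x h (I h.1 h.2)) = 0 := by
    rw [Derivation.leibniz, Ξ.δ_prod_eq_zero _ _ _ _ (fun h => I h.1 h.2),
      ← MvPolynomial.algebraMap_eq, Derivation.map_algebraMap, smul_zero, smul_zero, add_zero]
    rw [hqp, Finset.mem_erase, boundary, Finset.mem_filter, hpv]
    exact fun h => hvU h.2.2.1
  rw [hI, RingHom.map_mul, mul_assoc, gaussSeries_mul, Derivation.leibniz, derivationCoeff_C, hrest,
    map_zero, smul_zero, add_zero, derivation_expSeries _ (Ξ.constantCoeff_interaction coef u hu),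
    hδW, hδP, smul_eq_mul, map_sum, Finset.mul_sum, Finset.mul_sum, Finset.mul_sum, map_sum,
    Finset.mul_sum]
  refine Finset.sum_congr rfl fun J _ => ?_
  rw [← gaussSeries_scalar_mul]
  refine congrArg gaussSeries ?_
  have hJ : Ξ.contracted coef (insert v U) (Function.update I v J) =
      (MvPolynomial.C ((∏ v ∈ U, coef v (I v)) * if Ξ.Compatible U I then 1 else 0) *
        ∏ h ∈ (S.boundary U).erase q, Ξ.x h (I h.1 h.2)) *
      (MvPolynomial.C (coef v J *
        if Ξ.pairing q (I q.1 q.2) (Function.update I v J p.1 p.2) then 1 else 0) *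
        ∏ h ∈ at_v.erase p, Ξ.x h (Function.update I v J h.1 h.2)) := by
    have h1 : ∏ h ∈ (S.boundary U).erase q, Ξ.x h (Function.update I v J h.1 h.2) =
        ∏ h ∈ (S.boundary U).erase q, Ξ.x h (I h.1 h.2) :=
      Finset.prod_congr rfl fun h hh => by
        rw [hold J h (Finset.mem_filter.1 (Finset.mem_of_mem_erase hh)).2.1]
    have h2 : ∏ w ∈ U, coef w (Function.update I v J w) = ∏ w ∈ U, coef w (I w) :=
      Finset.prod_congr rfl fun w hw => by
        rw [Function.update_of_ne]
        rintro rfl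
        exact hvU hw
    rw [contracted, hbd, Finset.prod_union hdisj, h1, Finset.prod_insert hvU, h2,
      Function.update_self]
    simp only [hcompat J, ite_and, map_mul]
    split_ifs <;> simp
    ring
  rw [hJ]
  simp only [RingHom.map_mul]
  ring

-- Vertices are absorbed in order of depth. One of least depth outside `U` has its parent in `U`,
-- and no other edge to `U`, since a child in `U` would have its parent in `U`. The cardinalities
-- count the indices of absorbed vertices, over which the left side sums freely.
open Classical in
theorem sum_gaussSeries_contracted {r : S.Vert} (ρ : S.Rooting r)
    (hu : ∀ v, constantCoeff (u v) = 0) (n : ℕ) (U : Finset S.Vert)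
    (hn : Uᶜ.card = n) (hr : r ∈ U)
    (hU : ∀ v ∈ U, v ≠ r → (S.twin (ρ.parent v)).1 ∈ U) :
    ∑ I, gaussSeries (C (Ξ.contracted coef U I) * expSeries (Ξ.interaction coef u)) =
      (∏ v ∈ Uᶜ, (Fintype.card (Fin (S.deg v) → A) : ℂ⟦X⟧) * u v) *
        ∑ I, gaussSeries (C (Ξ.contracted coef Finset.univ I) *
          expSeries (Ξ.interaction coef u)) := by
  induction n generalizing U with
  | zero =>
    rw [Finset.card_eq_zero] at hn
    rw [hn, Finset.prod_empty, one_mul, (Finset.compl_eq_empty_iff U).1 hn]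
  | succ n ih =>
    obtain ⟨v, hv, hmin⟩ := Finset.exists_min_image Uᶜ ρ.depth
      (Finset.card_pos.1 (by omega))
    have hvU : v ∉ U := Finset.mem_compl.1 hv
    have hvr : v ≠ r := fun h => hvU (h ▸ hr)
    have hp : (S.twin (ρ.parent v)).1 ∈ U := by
      by_contra h
      have h1 := hmin _ (Finset.mem_compl.2 h)
      have h2 := ρ.depth_parent v hvr
      omega
    have huniq : ∀ h : S.Half, h.1 = v → (S.twin h).1 ∈ U → h = ρ.parent v := by
      intro h h1 h2
      rcases ρ.dichotomy h with ⟨_, h3⟩ | ⟨h3, h4⟩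
      · rw [h3, h1]
      · have := hU _ h2 h3
        rw [← h4, S.twin_twin, h1] at this
        exact absurd this hvU
    have hcompl : (insert v U)ᶜ = Uᶜ.erase v := by
      ext w
      simp
    have hstep := ih (insert v U)
      (by rw [hcompl, Finset.card_erase_of_mem hv, hn, Nat.add_sub_cancel])
      (Finset.mem_insert_of_mem hr) (by
        intro w hw hwr
        rcases Finset.mem_insert.1 hw with rfl | hw
        · exact Finset.mem_insert_of_mem hp
        · exact Finset.mem_insert_of_mem (hU w hw hwr))
    rw [Finset.sum_congr rfl fun I _ =>
      Ξ.gaussSeries_contracted coef u ρ hvr hvU hp huniq hu I, ← Finset.mul_sum]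
    have hupd := sum_sum_update (S := S) v fun I =>
      gaussSeries (C (Ξ.contracted coef (insert v U) I) * expSeries (Ξ.interaction coef u))
    rw [← Finset.mul_prod_erase _ _ hv, ← hcompl, mul_assoc, ← hstep]
    rw [hupd, nsmul_eq_mul]
    ring

-- Nothing leaves the set of all vertices, so no field remains and the contraction is a scalar.
omit [Fintype A] in
open Classical in
theorem gaussSeries_contracted_univ (I : ∀ v : S.Vert, Fin (S.deg v) → A)
    (f : (MvPolynomial (ι ⊕ ι) ℂ)⟦X⟧) :
    gaussSeries (C (Ξ.contracted coef Finset.univ I) * f) =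
      C (if Ξ.Compatible Finset.univ I then ∏ v, coef v (I v) else 0) * gaussSeries f := by
  have h : C (Ξ.contracted coef Finset.univ I) = (scalar (ι := ι)
      (C (if Ξ.Compatible Finset.univ I then ∏ v, coef v (I v) else 0))) := by
    rw [contracted, boundary, Finset.filter_false_of_mem (by simp), Finset.prod_empty, mul_one,
      scalar, PowerSeries.map_C]
    congr 2
    split_ifs <;> simp
  rw [h, gaussSeries_scalar_mul]

-- Starting point of the absorption: without loops, `{r}` has no internal edge and all half-edges at
-- `r` are in its boundary. The two prefactors compensate for summing over indices away from `r`.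
open Classical in
theorem sum_gaussSeries_contracted_singleton {r : S.Vert} (ρ : S.Rooting r)
    (f : (MvPolynomial (ι ⊕ ι) ℂ)⟦X⟧) :
    (Fintype.card (Fin (S.deg r) → A) : ℂ⟦X⟧) *
        ∑ I, gaussSeries (C (Ξ.contracted coef {r} I) * f) =
      (∏ v, (Fintype.card (Fin (S.deg v) → A) : ℂ⟦X⟧)) *
        gaussSeries (C (Ξ.vertexPoly coef r) * f) := by
  have hupd := sum_sum_update (S := S) r fun I => gaussSeries (C (Ξ.contracted coef {r} I) * f)
  have hI : ∀ I : ∀ v : S.Vert, Fin (S.deg v) → A,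
      ∑ J : Fin (S.deg r) → A, gaussSeries (C (Ξ.contracted coef {r} (Function.update I r J)) * f) =
        gaussSeries (C (Ξ.vertexPoly coef r) * f) := by
    intro I
    rw [Ξ.vertexPoly_eq coef r I, map_sum, Finset.sum_mul, map_sum]
    refine Finset.sum_congr rfl fun J _ => ?_
    have hc : Ξ.Compatible {r} (Function.update I r J) := by
      intro h h1 h2
      rw [Finset.mem_singleton] at h1 h2
      exact absurd (h2.trans h1.symm) (ρ.twin_fst_ne h)
    have hb : S.boundary {r} = Finset.univ.filter (fun h : S.Half => h.1 = r) := by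
      ext h
      simp only [boundary, Finset.mem_singleton, Finset.mem_filter, Finset.mem_univ, true_and,
        and_iff_left_iff_imp]
      exact fun h1 h2 => ρ.twin_fst_ne h (h2.trans h1.symm)
    rw [contracted, if_pos hc, Finset.prod_singleton, Function.update_self, mul_one, hb]
  rw [nsmul_eq_mul] at hupd
  rw [← hupd, Finset.sum_congr rfl fun I _ => hI I, Finset.sum_const, Finset.card_univ,
    Fintype.card_pi, nsmul_eq_mul, Nat.cast_prod]

open Classical in
/-- Inserting one vertex polynomial contracts the whole tree. -/
theorem gaussSeries_vertexPoly [Nonempty S.Half] [Nonempty A]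
    (hu : ∀ v, constantCoeff (u v) = 0) (r : S.Vert) :
    gaussSeries (C (Ξ.vertexPoly coef r) * expSeries (Ξ.interaction coef u)) =
      (∏ v ∈ Finset.univ.erase r, u v) * (C (Ξ.fullContraction coef) *
        gaussSeries (expSeries (Ξ.interaction coef u))) := by
  obtain ⟨ρ⟩ := S.nonempty_rooting r
  have h1 := Ξ.sum_gaussSeries_contracted coef u ρ hu _ {r} rfl (Finset.mem_singleton_self r)
    (fun v hv hr => absurd (Finset.mem_singleton.1 hv) hr)
  have h2 := Ξ.sum_gaussSeries_contracted_singleton coef ρ (expSeries (Ξ.interaction coef u))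
  have hcompl : ({r} : Finset S.Vert)ᶜ = Finset.univ.erase r := by
    ext w
    simp
  rw [h1, hcompl, Finset.prod_mul_distrib, ← mul_assoc, ← mul_assoc,
    Finset.mul_prod_erase _ (fun v => (Fintype.card (Fin (S.deg v) → A) : ℂ⟦X⟧))
      (Finset.mem_univ r), mul_assoc] at h2
  -- The multiplicities are nonzero constants because `A` is non-empty, so they cancel.
  have h0 : (∏ v, (Fintype.card (Fin (S.deg v) → A) : ℂ⟦X⟧)) ≠ 0 := by
    refine Finset.prod_ne_zero_iff.2 fun v _ => ?_
    rw [← map_natCast (C (R := ℂ)), map_ne_zero_iff _ C_injective]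
    exact Nat.cast_ne_zero.2 Fintype.card_ne_zero
  rw [← mul_left_cancel₀ h0 h2]
  rw [Finset.sum_congr rfl fun I _ => Ξ.gaussSeries_contracted_univ coef I _, ← Finset.sum_mul,
    fullContraction, map_sum]

/-- The Gaussian integral over all edges of a plane tree. -/
theorem gaussSeries_expSeries_interaction [Nonempty S.Half] [Nonempty A]
    (hu : ∀ v, constantCoeff (u v) = 0) :
    gaussSeries (expSeries (Ξ.interaction coef u)) =
      expSeries (C (Ξ.fullContraction coef) * ∏ v, u v) := by
  classical
  obtain ⟨r⟩ : Nonempty S.Vert := S.connected.nonempty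
  have h0 : constantCoeff (C (Ξ.fullContraction coef) * ∏ v, u v) = 0 := by
    rw [map_mul, map_prod, Finset.prod_eq_zero (Finset.mem_univ r) (hu r), mul_zero]
  -- The derivative is the sum over `v` of `(u v)'` times the expectation of the polynomial of `v`
  -- against the exponential. By `gaussSeries_vertexPoly` each such expectation supplies the
  -- couplings of all other vertices, and Leibniz reassembles the derivative of the product.
  refine eq_of_derivative_eq_mul ?_ (derivative_expSeries h0) ?_
  · have hD := derivation_expSeries ((d⁄dX (MvPolynomial (ι ⊕ ι) ℂ)).restrictScalars ℂ)
      (Ξ.constantCoeff_interaction coef u hu)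
    rw [Derivation.restrictScalars_apply, Derivation.restrictScalars_apply] at hD
    have hDW : d⁄dX _ (Ξ.interaction coef u) =
        ∑ v, scalar (d⁄dX ℂ (u v)) * C (Ξ.vertexPoly coef v) := by
      rw [interaction, map_sum]
      refine Finset.sum_congr rfl fun v _ => ?_
      rw [Derivation.leibniz, derivative_scalar, derivative_C, smul_zero, zero_add, smul_eq_mul,
        mul_comm]
    have hprod : ∀ s : Finset S.Vert, d⁄dX ℂ (∏ v ∈ s, u v) =
        ∑ v ∈ s, d⁄dX ℂ (u v) * ∏ w ∈ s.erase v, u w := by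
      intro s
      induction s using Finset.induction_on with
      | empty => simp
      | insert v s hv ih =>
        rw [Finset.prod_insert hv, Derivation.leibniz, ih, Finset.sum_insert hv,
          Finset.erase_insert hv, smul_eq_mul, smul_eq_mul, add_comm, mul_comm (∏ w ∈ s, u w),
          Finset.mul_sum]
        congr 1
        refine Finset.sum_congr rfl fun w hw => ?_
        rw [Finset.erase_insert_of_ne (by rintro rfl; exact hv hw), Finset.prod_insert
          (fun h => hv (Finset.mem_of_mem_erase h))]
        ring
    rw [derivative_gaussSeries, hD, hDW, Finset.mul_sum, map_sum, Derivation.leibniz, derivative_C,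
      smul_zero, add_zero, smul_eq_mul, hprod, Finset.mul_sum, Finset.mul_sum]
    refine Finset.sum_congr rfl fun v _ => ?_
    rw [mul_left_comm, gaussSeries_scalar_mul, mul_comm (expSeries _),
      Ξ.gaussSeries_vertexPoly coef u hu]
    ring
  · rw [constantCoeff_gaussSeries_expSeries, constantCoeff_expSeries]

end HalfEdgeField

end PlaneTree

/-! ### Matrix products as chains of independent index pairs. -/

section Chains

variable {E : Type*} [Fintype E] [DecidableEq E]

/-- The coefficient of `∏ i, M i (J i).1 (J i).2` in the expansion of `f (∏ i, M i) g`. -/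
def chainCoef {n : ℕ} (f g : E → ℂ) (J : Fin n → E × E) : ℂ :=
  if h : 0 < n then f (J ⟨0, h⟩).1 * g (J ⟨n - 1, Nat.sub_lt h one_pos⟩).2 *
    if ∀ i j : Fin n, (i : ℕ) + 1 = j → (J i).2 = (J j).1 then 1 else 0
  else 0

omit [Fintype E] in
theorem chainCoef_cons {n : ℕ} (f g : E → ℂ) (p : E × E) (J : Fin (n + 1) → E × E) :
    chainCoef f g (Fin.cons p J : Fin (n + 2) → E × E) =
      f p.1 * chainCoef (fun a => if p.2 = a then 1 else 0) g J := by
  have h1 : (Fin.cons p J : Fin (n + 2) → E × E) ⟨n + 2 - 1, by omega⟩ = J ⟨n + 1 - 1, by omega⟩ :=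
    rfl
  have h2 : (∀ i j : Fin (n + 2), (i : ℕ) + 1 = j → 
      ((Fin.cons p J : Fin (n + 2) → E × E) i).2 = ((Fin.cons p J : Fin (n + 2) → E × E) j).1) ↔
      p.2 = (J 0).1 ∧ ∀ i j : Fin (n + 1), (i : ℕ) + 1 = j → (J i).2 = (J j).1 := by
    constructor
    · intro h
      refine ⟨h 0 (Fin.succ 0) rfl, fun i j hij => h i.succ j.succ ?_⟩
      simp only [Fin.val_succ]
      omega
    · rintro ⟨h3, h4⟩ i j hij
      induction i using Fin.cases with
      | zero =>
        have : j = Fin.succ 0 := Fin.ext (by simpa using hij.symm)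
        subst this
        exact h3
      | succ i =>
        induction j using Fin.cases with
        | zero => simp at hij
        | succ j => exact h4 i j (by simpa using hij)
  rw [chainCoef, chainCoef, dif_pos (by omega), dif_pos (by omega), h1]
  simp only [h2]
  change f p.1 * _ * _ = f p.1 * ((if p.2 = (J 0).1 then 1 else 0) * _ * _)
  by_cases h3 : p.2 = (J 0).1 <;> simp [h3]

/-- Each matrix gets its own pair of indices and `chainCoef` forces neighbouring ones to agree,
which is the form required by `vertexPoly`. The empty product is excluded, as `chainCoef` is then
`0`. -/
theorem sum_mul_prod_mul {n : ℕ} (hn : 0 < n) (M : Fin n → Matrix E E ℂ) (f g : E → ℂ) :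
    ∑ a, ∑ b, f a * (List.ofFn M).prod a b * g b =
      ∑ J : Fin n → E × E, chainCoef f g J * ∏ i, M i (J i).1 (J i).2 := by
  obtain ⟨n, rfl⟩ := Nat.exists_eq_succ_of_ne_zero hn.ne'
  clear hn
  induction n generalizing f with
  | zero =>
    rw [← (Equiv.funUnique (Fin 1) (E × E)).symm.sum_comp, Fintype.sum_prod_type]
    refine Finset.sum_congr rfl fun a _ => Finset.sum_congr rfl fun b _ => ?_
    have h : ∀ i j : Fin 1, (i : ℕ) + 1 = j → False := fun i j h => by omega
    rw [chainCoef, dif_pos Nat.one_pos, if_pos fun i j hij => (h i j hij).elim]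
    simp
    ring
  | succ n ih =>
    rw [← (Fin.consEquiv fun _ : Fin (n + 2) => E × E).sum_comp, Fintype.sum_prod_type,
      Fintype.sum_prod_type]
    refine Finset.sum_congr rfl fun a _ => ?_
    have h : ∀ c : E, ∑ J : Fin (n + 1) → E × E,
        chainCoef f g (Fin.cons (a, c) J : Fin (n + 2) → E × E) *
          ∏ i, M i ((Fin.cons (a, c) J : Fin (n + 2) → E × E) i).1
            ((Fin.cons (a, c) J : Fin (n + 2) → E × E) i).2 =
        f a * M 0 a c * ∑ b, (List.ofFn fun i : Fin (n + 1) => M i.succ).prod c b * g b := by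
      intro c
      have := ih (fun a => if c = a then 1 else 0) (fun i => M i.succ)
      simp only [ite_mul, one_mul, zero_mul, Finset.sum_ite_irrel, Finset.sum_const_zero,
        Finset.sum_ite_eq, Finset.mem_univ, if_true] at this
      rw [this, Finset.mul_sum]
      refine Finset.sum_congr rfl fun J _ => ?_
      rw [chainCoef_cons, Fin.prod_univ_succ]
      simp only [Fin.cons_zero, Fin.cons_succ]
      ring
    refine Eq.trans ?_ (Finset.sum_congr rfl fun c _ => (h c).symm)
    rw [List.ofFn_succ, List.prod_cons]
    simp only [Matrix.mul_apply, Finset.mul_sum, Finset.sum_mul]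
    rw [Finset.sum_comm]
    refine Finset.sum_congr rfl fun c _ => Finset.sum_congr rfl fun b _ => ?_
    ring

end Chains

/-! ### The matrices on half-edges as Gaussian fields. -/

section CoordinateField

namespace PlaneTree

variable {d : ℕ} {S : PlaneTree d} {o : Finset S.Half} {N : ℕ}

/-- The coordinate of `X_e` selected by two basis vectors of `E_d`. -/
def coordAt (e : S.Half) (he : e ∈ o) (a b : Fin d → Fin N) : S.Coord o N :=
  ⟨⟨e, he⟩, fun c => a c, fun c => b c⟩

theorem coordAt_eq_iff {e e' : S.Half} {he : e ∈ o} {he' : e' ∈ o} {a b a' b' : Fin d → Fin N} :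
    coordAt e he a b = coordAt e' he' a' b' ↔
      e = e' ∧ ∀ c ∈ S.color e, a c = a' c ∧ b c = b' c := by
  constructor
  · intro h
    obtain ⟨h1, h2⟩ := Sigma.mk.inj_iff.1 h
    obtain rfl := congrArg Subtype.val h1
    obtain ⟨h3, h4⟩ := Prod.mk.inj (eq_of_heq h2)
    exact ⟨rfl, fun c hc => ⟨congrFun h3 ⟨c, hc⟩, congrFun h4 ⟨c, hc⟩⟩⟩
  · rintro ⟨rfl, h⟩
    rw [coordAt, coordAt]
    congr 2
    · exact funext fun c => (h c c.2).1
    · exact funext fun c => (h c c.2).2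

open Classical in
/-- The variable of the matrix entry of `X_h` selected by two basis vectors of `E_d`. -/
noncomputable def coordVar (ho : S.IsOrientation o) (h : S.Half)
    (p : (Fin d → Fin N) × (Fin d → Fin N)) : S.Coord o N ⊕ S.Coord o N :=
  if hh : h ∈ o then Sum.inl (coordAt h hh p.1 p.2)
  else Sum.inr (coordAt (S.twin h) ((ho h).2 hh) p.2 p.1)

/-- The matrices of twin half-edges are adjoint, so the conjugate of an entry is the transposed
entry on the twin. This is the covariance rule of the matrix model. -/
theorem coordVar_eq_swap_iff (ho : S.IsOrientation o) (h h' : S.Half)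
    (p p' : (Fin d → Fin N) × (Fin d → Fin N)) :
    coordVar ho h' p' = (coordVar ho h p).swap ↔
      h' = S.twin h ∧ ∀ c ∈ S.color h, p.1 c = p'.2 c ∧ p.2 c = p'.1 c := by
  by_cases hh : h ∈ o <;> by_cases hh' : h' ∈ o
  · simp only [coordVar, hh, hh', dif_pos, Sum.swap_inl, reduceCtorEq, false_iff]
    rintro ⟨rfl, -⟩
    exact (ho h).1 hh' hh
  · simp only [coordVar, hh, hh', dif_pos, Sum.swap_inl, dif_neg, not_false_eq_true, Sum.inr.injEq,
      coordAt_eq_iff, S.color_twin]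
    constructor
    · rintro ⟨rfl, h2⟩
      rw [S.color_twin]
      exact ⟨(S.twin_twin _).symm, fun c hc => ⟨(h2 c hc).1.symm, (h2 c hc).2.symm⟩⟩
    · rintro ⟨rfl, h2⟩
      rw [S.color_twin]
      exact ⟨S.twin_twin _, fun c hc => ⟨(h2 c hc).1.symm, (h2 c hc).2.symm⟩⟩
  · simp only [coordVar, hh, hh', dif_pos, Sum.swap_inr, dif_neg, not_false_eq_true, Sum.inl.injEq,
      coordAt_eq_iff]
    constructor
    · rintro ⟨rfl, h2⟩
      rw [S.color_twin] at h2
      exact ⟨rfl, fun c hc => ⟨(h2 c hc).2.symm, (h2 c hc).1.symm⟩⟩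
    · rintro ⟨rfl, h2⟩
      rw [S.color_twin]
      exact ⟨rfl, fun c hc => ⟨(h2 c hc).2.symm, (h2 c hc).1.symm⟩⟩
  · simp only [coordVar, hh, hh', Sum.swap_inr, dif_neg, not_false_eq_true, reduceCtorEq,
      false_iff]
    rintro ⟨rfl, -⟩
    exact hh' ((ho h).2 hh)

open Classical in
/-- The matrices `X̃_h` as Gaussian random fields. -/
noncomputable def matrixField (ho : S.IsOrientation o) (N : ℕ) :
    S.HalfEdgeField (S.Coord o N) ((Fin d → Fin N) × (Fin d → Fin N)) where
  x h p := if ∀ c ∉ S.color h, p.1 c = p.2 c then MvPolynomial.X (coordVar ho h p) else 0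
  δ h p := if ∀ c ∉ S.color h, p.1 c = p.2 c then MvPolynomial.pderiv (coordVar ho h p).swap else 0
  pairing h p p' := (∀ c ∈ S.color h, p.1 c = p'.2 c ∧ p.2 c = p'.1 c) ∧
    (∀ c ∉ S.color h, p.1 c = p.2 c) ∧ ∀ c ∉ S.color h, p'.1 c = p'.2 c
  pairing_twin h p p' := by
    rw [S.color_twin]
    constructor
    · rintro ⟨h1, h2, h3⟩
      exact ⟨fun c hc => ⟨(h1 c hc).2.symm, (h1 c hc).1.symm⟩, h3, h2⟩
    · rintro ⟨h1, h2, h3⟩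
      exact ⟨fun c hc => ⟨(h1 c hc).2.symm, (h1 c hc).1.symm⟩, h3, h2⟩
  gaussE_mul h p q := by
    split_ifs
    · exact gaussE_X_mul _ _
    · simp
  δ_twin h p p' := by
    have := coordVar_eq_swap_iff ho h (S.twin h) p p'
    rw [S.color_twin]
    by_cases h1 : ∀ c ∉ S.color h, p.1 c = p.2 c
    · by_cases h2 : ∀ c ∉ S.color h, p'.1 c = p'.2 c
      · simp only [if_pos h1, if_pos h2, MvPolynomial.pderiv_X, Pi.single_apply]
        split_ifs with h3 h4 h4
        · rfl
        · exact absurd ⟨(this.1 h3).2, h1, h2⟩ h4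
        · exact absurd (this.2 ⟨rfl, h4.1⟩) h3
        · rfl
      · rw [if_neg h2, map_zero, if_neg]
        exact fun h3 => h2 h3.2.2
    · rw [if_neg h1, Derivation.zero_apply, if_neg]
      exact fun h3 => h1 h3.2.1
  δ_ne h p h' p' hne := by
    have := coordVar_eq_swap_iff ho h h' p p'
    split_ifs
    · rw [MvPolynomial.pderiv_X, Pi.single_apply, if_neg fun h => hne (this.1 h).1]
    all_goals simp

theorem evalZ_matrixField (ho : S.IsOrientation o) (z : S.Coord o N → ℂ) (h : S.Half)
    (p : (Fin d → Fin N) × (Fin d → Fin N)) :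
    evalZ z ((matrixField ho N).x h p) = S.tildeMat z h p.1 p.2 := by
  have hprod : ∀ C : Finset (Fin d), (∏ c ∈ Cᶜ, if p.1 c = p.2 c then (1 : ℂ) else 0) =
      if ∀ c ∉ C, p.1 c = p.2 c then 1 else 0 := by
    intro C
    split_ifs with hC
    · exact Finset.prod_eq_one fun c hc => if_pos (hC c (Finset.mem_compl.1 hc))
    · push Not at hC
      obtain ⟨c, hc, hne⟩ := hC
      exact Finset.prod_eq_zero (Finset.mem_compl.2 hc) (if_neg hne)
  rw [tildeMat]
  by_cases hh : h ∈ o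
  · rw [dif_pos hh, extend, Matrix.of_apply, hprod]
    simp only [matrixField, coordVar, dif_pos hh]
    split_ifs
    · rw [evalZ, MvPolynomial.aeval_X, mul_one]
      rfl
    · simp
  · rw [dif_neg hh, dif_pos ((ho h).2 hh), extend, Matrix.of_apply, hprod]
    simp only [matrixField, coordVar, dif_neg hh, S.color_twin]
    split_ifs
    · rw [evalZ, MvPolynomial.aeval_X, mul_one]
      rfl
    · simp

/-- The product of the matrices around a vertex, between `T̄` and `T`. -/
theorem evalZ_vertexPoly (ho : S.IsOrientation o) (z : S.Coord o N → ℂ) (f g : (Fin d → Fin N) → ℂ)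
    (v : S.Vert) (hv : 0 < S.deg v) :
    evalZ z ((matrixField ho N).vertexPoly (fun _ => chainCoef f g) v) =
      ∑ a, ∑ b, f a * (List.ofFn fun i => S.tildeMat z ⟨v, i⟩).prod a b * g b := by
  rw [sum_mul_prod_mul hv, HalfEdgeField.vertexPoly, map_sum]
  refine Finset.sum_congr rfl fun J _ => ?_
  rw [map_mul, map_prod]
  congr 1
  · rw [evalZ, MvPolynomial.aeval_C]
    rfl
  · exact Finset.prod_congr rfl fun i _ => evalZ_matrixField ho z _ _

end PlaneTree

end CoordinateField

/-! ### From the full contraction of a tree to the bubble polynomial. -/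

namespace PlaneTree

variable {d : ℕ} {S : PlaneTree d}

/-- A boundary with at least one vertex comes from a tree with at least one edge. -/
theorem nonempty_half_of_isBoundary {B : ColoredGraph d} (hB : S.toGraph.IsBoundary B)
    (hV : 2 < B.numVert) : Nonempty S.Half := by
  obtain ⟨f, g, -⟩ := hB
  by_contra h
  rw [not_nonempty_iff] at h
  have h1 : IsEmpty B.W := ⟨fun w => h.false (f w).1⟩
  have h2 : IsEmpty B.K := ⟨fun w => h.false (g w).1⟩
  rw [ColoredGraph.numVert, Fintype.card_eq_zero, Fintype.card_eq_zero] at hV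
  omega

variable [Nonempty S.Half]

/-- The half-edge that precedes the marked corner of a vertex. -/
def lastHalf (S : PlaneTree d) [Nonempty S.Half] (v : S.Vert) : S.Half :=
  ⟨v, ⟨S.deg v - 1, Nat.sub_lt (S.deg_pos v) one_pos⟩⟩

/-- The half-edge that follows the marked corner of a vertex. -/
def firstHalf (S : PlaneTree d) [Nonempty S.Half] (v : S.Vert) : S.Half :=
  ⟨v, ⟨0, S.deg_pos v⟩⟩

theorem not_dash_left_iff (h : S.Half) : (∀ k, ¬S.toGraph.dash h k) ↔ h = S.lastHalf h.1 := by
  obtain ⟨v, i⟩ := h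
  constructor
  · intro hh
    refine congrArg (Sigma.mk v) (Fin.ext ?_)
    have hi := i.2
    by_contra hne
    dsimp only at hne
    refine hh ⟨v, ⟨i + 1, ?_⟩⟩ ⟨rfl, rfl⟩
    omega
  · rintro hh ⟨w, j⟩ ⟨h1, h2⟩
    dsimp only at h1
    subst h1
    have h3 : i = ⟨S.deg v - 1, _⟩ := eq_of_heq (Sigma.mk.inj_iff.1 hh).2
    have h4 := j.2
    have h5 := congrArg Fin.val h3
    dsimp only at h2 h5
    omega

theorem not_dash_right_iff (k : S.Half) : (∀ h, ¬S.toGraph.dash h k) ↔ k = S.firstHalf k.1 := by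
  obtain ⟨v, i⟩ := k
  constructor
  · intro hh
    refine congrArg (Sigma.mk v) (Fin.ext ?_)
    by_contra hne
    dsimp only at hne
    refine hh ⟨v, ⟨i - 1, ?_⟩⟩ ⟨rfl, ?_⟩
    · have := i.2
      omega
    · dsimp only
      omega
  · rintro hh ⟨w, j⟩ ⟨h1, h2⟩
    dsimp only at h1
    subst h1
    have h3 : i = ⟨0, _⟩ := eq_of_heq (Sigma.mk.inj_iff.1 hh).2
    have h5 := congrArg Fin.val h3
    dsimp only at h2 h5
    omega

/-- The vertices without dashed line, white ones. -/
def unmatchedWhite (S : PlaneTree d) [Nonempty S.Half] :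
    {w : S.toGraph.W // ∀ k, ¬S.toGraph.dash w k} ≃ S.Vert where
  toFun w := Sigma.fst (β := fun v => Fin (S.deg v)) w.1
  invFun v := ⟨S.lastHalf v, (not_dash_left_iff _).2 rfl⟩
  left_inv w := Subtype.ext ((not_dash_left_iff w.1).1 w.2).symm
  right_inv _ := rfl

/-- The vertices without dashed line, black ones. -/
def unmatchedBlack (S : PlaneTree d) [Nonempty S.Half] :
    {k : S.toGraph.K // ∀ w, ¬S.toGraph.dash w k} ≃ S.Vert where
  toFun w := Sigma.fst (β := fun v => Fin (S.deg v)) w.1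
  invFun v := ⟨S.firstHalf v, (not_dash_right_iff _).2 rfl⟩
  left_inv w := Subtype.ext ((not_dash_right_iff w.1).1 w.2).symm
  right_inv _ := rfl

/-- The edges of color `c`, as a permutation of the half-edges. -/
def edgePerm (S : PlaneTree d) (c : Fin d) : Equiv.Perm S.Half := S.toGraph.edge c

/-- The half-edge `k` follows `h` around a vertex, after an unmarked corner. -/
def Follows (S : PlaneTree d) (h k : S.Half) : Prop := S.toGraph.dash h k

/-- Contracting the dashed lines leaves, at each marked corner, the white vertex before it and the
black vertex after it. Both kinds of bubble vertices are thus indexed by the tree vertices. -/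
theorem exists_equiv_of_isBoundary {B : ColoredGraph d} (hB : S.toGraph.IsBoundary B) :
    ∃ (f : B.W ≃ S.Vert) (g : B.K ≃ S.Vert), ∀ c w,
      S.toGraph.Path c (S.lastHalf (f w)) (S.firstHalf (g (B.edge c w))) := by
  obtain ⟨f, g, h⟩ := hB
  refine ⟨f.trans S.unmatchedWhite, g.trans S.unmatchedBlack, fun c w => ?_⟩
  have h1 := ((not_dash_left_iff (f w).1).1 (f w).2)
  have h2 := ((not_dash_right_iff (g (B.edge c w)).1).1 (g (B.edge c w)).2)
  have h3 := h c w
  rw [h1, h2] at h3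
  exact h3

/-- This is where the exponent `V - 2` comes from: one factor of the coupling per half-edge. -/
theorem card_half_of_isBoundary {B : ColoredGraph d} (hB : S.toGraph.IsBoundary B) :
    B.numVert = Fintype.card S.Half + 2 := by
  obtain ⟨f, g, -⟩ := exists_equiv_of_isBoundary hB
  rw [ColoredGraph.numVert, Fintype.card_congr f, Fintype.card_congr g, ← two_mul]
  exact S.card_vert

omit [Nonempty S.Half] in
theorem edgePerm_symm_apply (c : Fin d) (h : S.Half) :
    (S.edgePerm c).symm h = if c ∈ S.color h then S.twin h else h := rfl

omit [Nonempty S.Half] in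
theorem wellFounded_follows (S : PlaneTree d) (c : Fin d) :
    WellFounded fun h' h : S.Half => S.Follows h (S.edgePerm c h') :=
  S.wellFounded_dash_edge c

omit [Nonempty S.Half] in
theorem _root_.GMModel.DashedGraph.Path.apply_eq {G : DashedGraph d} {α : Type*} {c : Fin d}
    {φ : G.W → α} (hφ : ∀ h h', G.dash h (G.edge c h') → φ h = φ h') {w : G.W} {k : G.K}
    (hp : G.Path c w k) : φ w = φ ((G.edge c).symm k) := by
  induction hp with
  | single => rw [Equiv.symm_apply_apply]
  | step k w' _ hd ih =>
    rw [Equiv.symm_apply_apply, ih, hφ w' ((G.edge c).symm k)]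
    rwa [Equiv.apply_symm_apply]

/-- A half-edge is the last one of its vertex, or there is a half-edge before it on the path of
color `c`. -/
theorem eq_lastHalf_or_exists_follows (c : Fin d) (h : S.Half) :
    h = S.lastHalf h.1 ∨ ∃ h', S.Follows h (S.edgePerm c h') := by
  by_cases hh : ∀ k, ¬S.toGraph.dash h k
  · exact Or.inl ((not_dash_left_iff h).1 hh)
  · push Not at hh
    obtain ⟨k, hk⟩ := hh
    refine Or.inr ⟨(S.edgePerm c).symm k, ?_⟩
    exact (Equiv.apply_symm_apply (S.edgePerm c) k).symm ▸ hk

theorem not_follows_lastHalf (v : S.Vert) (k : S.Half) : ¬S.Follows (S.lastHalf v) k :=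
  (not_dash_left_iff (S.lastHalf v)).2 rfl k

/-- Every half-edge is on the path of color `c` that starts at the last half-edge of some vertex. -/
theorem exists_origin (S : PlaneTree d) [Nonempty S.Half] (c : Fin d) :
    ∃ origin : S.Half → S.Vert, (∀ v, origin (S.lastHalf v) = v) ∧
      ∀ h h', S.Follows h (S.edgePerm c h') → origin h = origin h' := by
  have hwf := S.wellFounded_follows c
  have hex : ∀ h : S.Half, ∃ v : S.Vert,
      Relation.ReflTransGen (fun h' h : S.Half => S.Follows h (S.edgePerm c h'))
        (S.lastHalf v) h := by
    intro h
    induction h using hwf.induction with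
    | _ h ih =>
      rcases eq_lastHalf_or_exists_follows c h with hh | ⟨h', hh⟩
      · exact ⟨h.1, hh ▸ .refl⟩
      · obtain ⟨w, hw⟩ := ih _ hh
        exact ⟨w, hw.tail hh⟩
  -- Steps are reversible in a unique way, since dashed lines and edges are both injective, and no
  -- step ends at a last half-edge.
  have huniq : ∀ (h : S.Half) (v v' : S.Vert),
      Relation.ReflTransGen (fun h' h : S.Half => S.Follows h (S.edgePerm c h'))
        (S.lastHalf v) h →
      Relation.ReflTransGen (fun h' h : S.Half => S.Follows h (S.edgePerm c h'))
        (S.lastHalf v') h → v = v' := by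
    intro h v v' h1 h2
    induction h using hwf.induction with
    | _ h ih =>
      rcases Relation.ReflTransGen.cases_tail h1 with h3 | ⟨a, h3, h4⟩ <;>
      rcases Relation.ReflTransGen.cases_tail h2 with h5 | ⟨b, h5, h6⟩
      · exact congrArg Sigma.fst (h3.symm.trans h5)
      · exact absurd h6 (h3 ▸ not_follows_lastHalf v _)
      · exact absurd h4 (h5 ▸ not_follows_lastHalf v' _)
      · have := (S.edgePerm c).injective (S.toGraph.dash_left _ _ _ h4 h6)
        subst this
        exact ih a h4 h3 h5
  choose origin ho using hex
  refine ⟨origin, fun w => huniq _ _ _ (ho _) .refl, fun h h' hh => ?_⟩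
  exact huniq _ _ _ (ho h) ((ho h').tail hh)

/-- Quantities constant along the paths of color `c` are determined by their values at the starting
points, which leaves one free index per color and white vertex. -/
theorem apply_lastHalf_origin {c : Fin d} {origin : S.Half → S.Vert}
    (h0 : ∀ v, origin (S.lastHalf v) = v)
    (h1 : ∀ h h', S.Follows h (S.edgePerm c h') → origin h = origin h') {α : Type*}
    {φ : S.Half → α} (hφ : ∀ h h', S.Follows h (S.edgePerm c h') → φ h = φ h') (h : S.Half) :
    φ (S.lastHalf (origin h)) = φ h := by
  induction h using (S.wellFounded_follows c).induction with
  | _ h ih =>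
    rcases eq_lastHalf_or_exists_follows c h with hh | ⟨h', hh⟩
    · rw [hh, h0]
    · rw [hφ _ _ hh, h1 _ _ hh]
      exact ih _ hh

-- For a color on the edge the covariance ties a row index to the column index of the twin; for any
-- other color the identity factor ties it to the column index of the same half-edge. Both are the
-- permutation `edgePerm`.
omit [Nonempty S.Half] in
theorem matrixField_compatible_univ {o : Finset S.Half} (ho : S.IsOrientation o) {N : ℕ}
    (I : ∀ v : S.Vert, Fin (S.deg v) → (Fin d → Fin N) × (Fin d → Fin N)) :
    (matrixField ho N).Compatible Finset.univ I ↔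
      ∀ (h : S.Half) c, (I h.1 h.2).1 c =
        (I ((S.edgePerm c).symm h).1 ((S.edgePerm c).symm h).2).2 c := by
  constructor
  · intro hI h c
    obtain ⟨h1, h2, h3⟩ := hI h (Finset.mem_univ _) (Finset.mem_univ _)
    rw [edgePerm_symm_apply]
    by_cases hc : c ∈ S.color h
    · rw [if_pos hc]
      exact (h1 c hc).1
    · rw [if_neg hc]
      exact h2 c hc
  · intro hI h _ _
    refine ⟨fun c hc => ⟨?_, ?_⟩, fun c hc => ?_, fun c hc => ?_⟩
    · rw [hI h c, edgePerm_symm_apply, if_pos hc]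
    · rw [hI (S.twin h) c, edgePerm_symm_apply, S.color_twin, if_pos hc, S.twin_twin]
    · rw [hI h c, edgePerm_symm_apply, if_neg hc]
    · rw [hI (S.twin h) c, edgePerm_symm_apply, S.color_twin, if_neg hc]

/-- Contracting all half-edges with the tensors at the marked corners gives the polynomial of the
encoded bubble. -/
theorem fullContraction_eq_poly {B : ColoredGraph d} (hB : S.toGraph.IsBoundary B)
    {o : Finset S.Half} (ho : S.IsOrientation o) {N : ℕ} (T : (Fin d → Fin N) → ℂ) :
    (matrixField ho N).fullContraction (fun _ => chainCoef (fun a => (starRingEnd ℂ) (T a)) T) =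
      B.poly T := by
  classical
  obtain ⟨f, g, hpath⟩ := exists_equiv_of_isBoundary hB
  choose origin horigin horigin' using fun c => S.exists_origin c
  -- A column index is copied from the white vertex at the origin of its path, and in `e` a row
  -- index is the column index across the colored edge. The image of `e` contains all assignments
  -- with nonzero contribution.
  let colOf : (Fin d → B.W → Fin N) → S.Half → Fin d → Fin N :=
    fun a h c => a c (f.symm (origin c h))
  let e : (Fin d → B.W → Fin N) → ∀ v : S.Vert, Fin (S.deg v) → (Fin d → Fin N) × (Fin d → Fin N) :=
    fun a v i => (fun c => colOf a ((S.edgePerm c).symm ⟨v, i⟩) c, colOf a ⟨v, i⟩)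
  have hinv : ∀ a c h h', S.Follows h (S.edgePerm c h') → colOf a h c = colOf a h' c :=
    fun a c h h' hh => by simp only [colOf, horigin' c h h' hh]
  have hlast : ∀ a v c, colOf a (S.lastHalf v) c = a c (f.symm v) :=
    fun a v c => by simp only [colOf, horigin]
  rw [HalfEdgeField.fullContraction, ColoredGraph.poly]
  symm
  refine Finset.sum_of_injOn e ?_ (fun _ _ => Finset.mem_coe.2 (Finset.mem_univ _)) ?_ ?_
  · intro a _ a' _ haa
    funext c w
    have h1 : colOf a (S.lastHalf (f w)) = colOf a' (S.lastHalf (f w)) :=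
      congrArg Prod.snd (congrFun (congrFun haa (f w)) (S.lastHalf (f w)).2)
    have h2 := congrFun h1 c
    rwa [hlast, hlast, Equiv.symm_apply_apply] at h2
  · intro I _ hI
    by_contra hne
    refine hI ?_
    have hc : (matrixField ho N).Compatible Finset.univ I := by
      by_contra h
      exact hne (if_neg h)
    rw [if_pos hc] at hne
    have hchain : ∀ (v : S.Vert) (i j : Fin (S.deg v)), (i : ℕ) + 1 = j →
        (I v i).2 = (I v j).1 := by
      intro v
      by_contra h
      refine Finset.prod_ne_zero_iff.1 hne v (Finset.mem_univ v) ?_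
      rw [chainCoef, dif_pos (S.deg_pos v), if_neg h, mul_zero]
    have hdash : ∀ h k : S.Half, S.Follows h k → (I h.1 h.2).2 = (I k.1 k.2).1 := by
      rintro ⟨v, i⟩ ⟨w, j⟩ ⟨h1, h2⟩
      dsimp only at h1
      subst h1
      exact hchain v i j h2
    rw [matrixField_compatible_univ] at hc
    have hcol : ∀ c (h h' : S.Half), S.Follows h (S.edgePerm c h') →
        (I h.1 h.2).2 c = (I h'.1 h'.2).2 c := by
      intro c h h' hh
      rw [hdash _ _ hh, hc, Equiv.symm_apply_apply]
    refine ⟨fun c w => (I (f w) (S.lastHalf (f w)).2).2 c, Finset.mem_coe.2 (Finset.mem_univ _), ?_⟩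
    have hcolOf : ∀ h : S.Half, colOf (fun c w => (I (f w) (S.lastHalf (f w)).2).2 c) h =
        (I h.1 h.2).2 := by
      intro h
      funext c
      have h1 := apply_lastHalf_origin (horigin c) (horigin' c)
        (φ := fun h : S.Half => (I h.1 h.2).2 c) (hcol c) h
      have h2 : ∀ v v' : S.Vert, v = v' →
          (I v (S.lastHalf v).2).2 c = (I v' (S.lastHalf v').2).2 c := by
        rintro v _ rfl
        rfl
      exact (h2 _ _ (f.apply_symm_apply _)).trans h1
    funext v i
    refine Prod.ext ?_ (hcolOf ⟨v, i⟩)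
    funext c
    simp only [e]
    rw [hcolOf, ← hc]
  · intro a _
    have hc : (matrixField ho N).Compatible Finset.univ (e a) :=
      (matrixField_compatible_univ ho _).2 fun h c => rfl
    rw [if_pos hc]
    have hchain : ∀ (v : S.Vert) (i j : Fin (S.deg v)), (i : ℕ) + 1 = j →
        (e a v i).2 = (e a v j).1 := by
      intro v i j hij
      funext c
      refine hinv a c _ _ ?_
      rw [Equiv.apply_symm_apply]
      exact ⟨rfl, hij⟩
    have hcoef : ∀ v, chainCoef (fun a => (starRingEnd ℂ) (T a)) T (e a v) =
        T (colOf a (S.lastHalf v)) *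
          (starRingEnd ℂ) (T fun c => colOf a ((S.edgePerm c).symm (S.firstHalf v)) c) := by
      intro v
      rw [chainCoef, dif_pos (S.deg_pos v), if_pos (hchain v), mul_one, mul_comm]
      rfl
    rw [Finset.prod_congr rfl fun v _ => hcoef v, Finset.prod_mul_distrib, ← f.prod_comp,
      ← g.prod_comp]
    congr 1
    · refine Finset.prod_congr rfl fun w _ => congrArg T (funext fun c => ?_)
      rw [hlast, Equiv.symm_apply_apply]
    · refine Finset.prod_congr rfl fun k _ => congrArg _ (congrArg T (funext fun c => ?_))
      -- The path of color `c` that ends at `k` starts at its neighbour in `B`, so the row index at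
      -- the first half-edge is the index that `poly` puts on that edge.
      have h2 := hpath c ((B.edge c).symm k)
      rw [Equiv.apply_symm_apply] at h2
      have h3 := h2.apply_eq (φ := fun h => colOf a h c) (hinv a c)
      rw [← Equiv.symm_apply_apply f ((B.edge c).symm k), ← hlast a]
      exact h3

end PlaneTree

/-! ### Polynomial functions and absolute convergence. -/

section PolynomialFunctions

variable {κ : Type*}

/-- Polynomial functions of complex variables and their conjugates. -/
def IsPolyFun (f : (κ → ℂ) → ℂ) : Prop := ∃ p : MvPolynomial (κ ⊕ κ) ℂ, ∀ z, f z = evalZ z p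

namespace IsPolyFun

theorem const (c : ℂ) : IsPolyFun fun _ : κ → ℂ => c :=
  ⟨MvPolynomial.C c, fun z => by rw [evalZ, MvPolynomial.aeval_C]; rfl⟩

theorem coord (i : κ) : IsPolyFun fun z : κ → ℂ => z i :=
  ⟨MvPolynomial.X (Sum.inl i), fun z => by rw [evalZ, MvPolynomial.aeval_X]; rfl⟩

theorem conj_coord (i : κ) : IsPolyFun fun z : κ → ℂ => (starRingEnd ℂ) (z i) :=
  ⟨MvPolynomial.X (Sum.inr i), fun z => by rw [evalZ, MvPolynomial.aeval_X]; rfl⟩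

theorem mul {f g : (κ → ℂ) → ℂ} (hf : IsPolyFun f) (hg : IsPolyFun g) :
    IsPolyFun fun z => f z * g z := by
  obtain ⟨p, hp⟩ := hf
  obtain ⟨q, hq⟩ := hg
  exact ⟨p * q, fun z => by rw [map_mul, ← hp, ← hq]⟩

theorem sum {α : Type*} (s : Finset α) {f : α → (κ → ℂ) → ℂ} (hf : ∀ i, IsPolyFun (f i)) :
    IsPolyFun fun z => ∑ i ∈ s, f i z := by
  choose p hp using hf
  exact ⟨∑ i ∈ s, p i, fun z => by rw [map_sum]; exact Finset.sum_congr rfl fun i _ => hp i z⟩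

theorem prod {α : Type*} (s : Finset α) {f : α → (κ → ℂ) → ℂ} (hf : ∀ i, IsPolyFun (f i)) :
    IsPolyFun fun z => ∏ i ∈ s, f i z := by
  choose p hp using hf
  exact ⟨∏ i ∈ s, p i, fun z => by rw [map_prod]; exact Finset.prod_congr rfl fun i _ => hp i z⟩

theorem pow {f : (κ → ℂ) → ℂ} (hf : IsPolyFun f) (n : ℕ) : IsPolyFun fun z => f z ^ n := by
  obtain ⟨p, hp⟩ := hf
  exact ⟨p ^ n, fun z => by rw [map_pow, ← hp]⟩

theorem comp {μ : Type*} {f : (μ → ℂ) → ℂ} (hf : IsPolyFun f) (e : μ → κ) :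
    IsPolyFun fun z : κ → ℂ => f fun i => z (e i) := by
  obtain ⟨p, hp⟩ := hf
  refine ⟨MvPolynomial.rename (Sum.map e e) p, fun z => ?_⟩
  refine (hp _).trans ?_
  rw [evalZ, evalZ, MvPolynomial.aeval_rename]
  congr 2
  funext x
  rcases x with x | x <;> rfl

theorem coeff_pow {W : (κ → ℂ) → ℂ⟦X⟧} (hW : ∀ n, IsPolyFun fun z => coeff n (W z)) (m n : ℕ) :
    IsPolyFun fun z => coeff n (W z ^ m) := by
  induction m generalizing n with
  | zero =>
    simp only [pow_zero]
    exact const _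
  | succ m ih =>
    simp only [pow_succ, coeff_mul]
    exact sum _ fun p => (ih p.1).mul (hW p.2)

theorem coeff_expSeries {W : (κ → ℂ) → ℂ⟦X⟧} (hW : ∀ n, IsPolyFun fun z => coeff n (W z)) (n : ℕ) :
    IsPolyFun fun z => coeff n (expSeries (W z)) := by
  simp only [expSeries, coeff_mk, smul_eq_mul]
  exact sum _ fun m => (const _).mul (coeff_pow hW m n)

open MeasureTheory in
theorem integrable [Fintype κ] {f : (κ → ℂ) → ℂ} (hf : IsPolyFun f) :
    Integrable fun z => f z * gaussWeight z := by
  obtain ⟨p, hp⟩ := hf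
  simp_rw [hp]
  exact integrable_evalZ_mul_gaussWeight p

-- The Gaussian weight factorizes over a disjoint union of variables; joint integrability is what
-- Fubini requires.
open MeasureTheory in
theorem integrable_prod {ι μ : Type*} [Fintype ι] [Fintype μ] {f : (ι ⊕ μ → ℂ) → ℂ}
    (hf : IsPolyFun f) :
    Integrable fun p : (ι → ℂ) × (μ → ℂ) =>
      f (Sum.elim p.1 p.2) * (gaussWeight p.1 * gaussWeight p.2) := by
  have h := (volume_measurePreserving_sumPiEquivProdPi_symm
    (fun _ : ι ⊕ μ => ℂ)).integrable_comp_of_integrable hf.integrable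
  refine h.congr (Filter.Eventually.of_forall fun p => ?_)
  have he : (MeasurableEquiv.sumPiEquivProdPi fun _ : ι ⊕ μ => ℂ).symm p = Sum.elim p.1 p.2 := by
    funext x
    rcases x with x | x <;> rfl
  simp only [Function.comp_apply, he]
  rw [gaussWeight, gaussWeight, gaussWeight, ← Complex.exp_add, Fintype.sum_sum_type, neg_add]
  simp only [Sum.elim_inl, Sum.elim_inr]

end IsPolyFun

end PolynomialFunctions

theorem coeff_tensorWeight {d : ℕ} (B : ColoredGraph d) (N : ℕ) (s : ℝ) (T : (Fin d → Fin N) → ℂ)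
    (n : ℕ) : coeff n (tensorWeight B N s T) = gaussWeight T *
      ((n.factorial : ℂ)⁻¹ * (-(((N : ℝ) ^ s : ℝ) : ℂ) * B.poly T) ^ n) := by
  have h0 : constantCoeff (-C (∑ a, T a * (starRingEnd ℂ) (T a)) -
      C (((N : ℝ) ^ s : ℝ) : ℂ) * X * C (B.poly T)) = -∑ a, T a * (starRingEnd ℂ) (T a) := by
    simp
  rw [tensorWeight, fexp_eq, h0, coeff_C_mul, ← coeff_expSeries_C_mul_X]
  congr 3
  simp only [map_neg, map_mul]
  ring

theorem formallyIntegrable_tensorWeight {d : ℕ} (B : ColoredGraph d) (N : ℕ) (s : ℝ) :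
    FormallyIntegrable (tensorWeight B N s) := by
  intro n
  simp_rw [coeff_tensorWeight, mul_comm (gaussWeight _)]
  refine IsPolyFun.integrable ((IsPolyFun.const _).mul (IsPolyFun.pow ?_ n))
  refine (IsPolyFun.const _).mul ?_
  refine IsPolyFun.sum _ fun a => (IsPolyFun.prod _ fun w => ?_).mul (IsPolyFun.prod _ fun k => ?_)
  · exact IsPolyFun.coord _
  · exact IsPolyFun.conj_coord _

theorem coeff_tensorZ_subst {d : ℕ} (B : ColoredGraph d) (N : ℕ) (s : ℝ) {k : ℕ} (hk : k ≠ 0)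
    (n : ℕ) : coeff n ((tensorZ B N s).subst (X ^ k : ℂ⟦X⟧)) =
      ((Real.pi : ℂ) ^ Fintype.card (Fin d → Fin N))⁻¹ * ∫ T : (Fin d → Fin N) → ℂ,
        coeff n (expSeries (C (-(((N : ℝ) ^ s : ℝ) : ℂ) * B.poly T) * X ^ k)) * gaussWeight T := by
  rw [coeff_subst_X_pow hk]
  simp_rw [coeff_expSeries_C_mul_X_pow hk]
  split_ifs
  · rw [tensorZ, formalIntegral, coeff_mk]
    simp_rw [coeff_tensorWeight, mul_comm (gaussWeight _)]
    simp
  · simp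

/-! ### The mixed model and its two partial integrations. -/

section MatrixModel

namespace PlaneTree

variable {d : ℕ} {S : PlaneTree d} {o : Finset S.Half} {N : ℕ}

/-- The coupling of a vertex. -/
noncomputable def vertexCoupling (S : PlaneTree d) (ε : S.Half → ℤˣ) (g : ℂ⟦X⟧) (v : S.Vert) :
    ℂ⟦X⟧ :=
  ∏ i : Fin (S.deg v), g * C (((ε ⟨v, i⟩ : ℤˣ) : ℤ) : ℂ)

/-- The exponent `T̄ (∑ v, ∏ h, g ε_h X̃_h) T` of the intermediate field representation. -/
noncomputable def mixedAction (ε : S.Half → ℤˣ) (g : ℂ⟦X⟧) (z : S.Coord o N → ℂ)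
    (T : (Fin d → Fin N) → ℂ) : ℂ⟦X⟧ :=
  ∑ v, S.vertexCoupling ε g v * C (∑ a, ∑ b, (starRingEnd ℂ) (T a) *
    (List.ofFn fun i : Fin (S.deg v) => S.tildeMat z ⟨v, i⟩).prod a b * T b)

theorem list_prod_smul {n : Type*} [Fintype n] [DecidableEq n] {m : ℕ} (c : Fin m → ℂ⟦X⟧)
    (A : Fin m → Matrix n n ℂ) :
    (List.ofFn fun i => c i • (A i).map C).prod = (∏ i, c i) • ((List.ofFn A).prod).map C := by
  induction m with
  | zero => simp
  | succ m ih =>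
    rw [List.ofFn_succ, List.prod_cons, ih, List.ofFn_succ, List.prod_cons, Fin.prod_univ_succ,
      Matrix.map_mul, smul_mul_smul_comm]

theorem vertexSum_eq (ε : S.Half → ℤˣ) (g : ℂ⟦X⟧) (z : S.Coord o N → ℂ) :
    vertexSum S ε g z = ∑ v, S.vertexCoupling ε g v •
      ((List.ofFn fun i : Fin (S.deg v) => S.tildeMat z ⟨v, i⟩).prod).map C :=
  Finset.sum_congr rfl fun _ _ => list_prod_smul _ _

/-- At fixed matrices the mixed action is a quadratic form in `T`; `map_interaction` reads the same
action, at fixed `T`, as a sum of vertex polynomials in the matrix entries. -/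
theorem map_quadraticForm_vertexSum (ε : S.Half → ℤˣ) (g : ℂ⟦X⟧) (z : S.Coord o N → ℂ)
    (T : (Fin d → Fin N) → ℂ) :
    PowerSeries.map (evalZ T : _ →+* ℂ) (quadraticForm (vertexSum S ε g z)) =
      mixedAction ε g z T := by
  simp only [quadraticForm, map_sum, map_mul, map_scalar, PowerSeries.map_C, mixedAction, vertexSum_eq,
    Matrix.sum_apply, Matrix.smul_apply, Matrix.map_apply, smul_eq_mul, Finset.mul_sum,
    Finset.sum_mul]
  simp only [evalZ, RingHom.coe_coe, MvPolynomial.aeval_X, Sum.elim_inl, Sum.elim_inr]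
  rw [Finset.sum_congr rfl fun a _ => Finset.sum_comm, Finset.sum_comm]
  refine Finset.sum_congr rfl fun v _ => Finset.sum_congr rfl fun a _ =>
    Finset.sum_congr rfl fun b _ => ?_
  ring

/-- Every vertex has a half-edge and hence at least one factor `g`, so the logarithm and exponential
series have no constant term to resum. -/
theorem constantCoeff_vertexCoupling [Nonempty S.Half] (ε : S.Half → ℤˣ) {g : ℂ⟦X⟧}
    (hg : constantCoeff g = 0) (v : S.Vert) : constantCoeff (S.vertexCoupling ε g v) = 0 := by
  rw [vertexCoupling, map_prod]
  refine Finset.prod_eq_zero (Finset.mem_univ ⟨0, S.deg_pos v⟩) ?_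
  rw [map_mul, hg, zero_mul]

theorem constantCoeff_vertexSum [Nonempty S.Half] (ε : S.Half → ℤˣ) {g : ℂ⟦X⟧}
    (hg : constantCoeff g = 0) (z : S.Coord o N → ℂ) (a b : Fin d → Fin N) :
    constantCoeff (vertexSum S ε g z a b) = 0 := by
  rw [vertexSum_eq, Matrix.sum_apply, map_sum]
  refine Finset.sum_eq_zero fun v _ => ?_
  rw [Matrix.smul_apply, smul_eq_mul, map_mul, constantCoeff_vertexCoupling ε hg, zero_mul]

theorem map_interaction [Nonempty S.Half] (ho : S.IsOrientation o) (ε : S.Half → ℤˣ) (g : ℂ⟦X⟧)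
    (z : S.Coord o N → ℂ) (T : (Fin d → Fin N) → ℂ) :
    PowerSeries.map (evalZ z : _ →+* ℂ) ((matrixField ho N).interaction
      (fun _ => chainCoef (fun a => (starRingEnd ℂ) (T a)) T) (S.vertexCoupling ε g)) =
      mixedAction ε g z T := by
  rw [HalfEdgeField.interaction, map_sum, mixedAction]
  refine Finset.sum_congr rfl fun v _ => ?_
  rw [map_mul, map_scalar, PowerSeries.map_C]
  congr 2
  exact evalZ_vertexPoly ho z _ _ v (S.deg_pos v)

theorem coeff_matrixWeight (ε : S.Half → ℤˣ) (g : ℂ⟦X⟧) (z : S.Coord o N → ℂ) (n : ℕ) :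
    coeff n (matrixWeight S o N ε g z) = gaussWeight z *
      coeff n (expSeries (-(matLog (1 - vertexSum S ε g z)).trace)) := by
  have h0 : constantCoeff (-C (∑ e : o, (S.mat z e * (S.mat z e).conjTranspose).trace) -
      (matLog (1 - vertexSum S ε g z)).trace) =
      -∑ e : o, (S.mat z e * (S.mat z e).conjTranspose).trace := by
    rw [map_sub, constantCoeff_trace_matLog]
    simp
  have h1 : ∑ e : o, (S.mat z e * (S.mat z e).conjTranspose).trace =
      ∑ i, z i * (starRingEnd ℂ) (z i) := by
    rw [Fintype.sum_sigma]
    refine Finset.sum_congr rfl fun e _ => ?_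
    rw [Fintype.sum_prod_type]
    rfl
  rw [matrixWeight, fexp_eq, h0, coeff_C_mul, h1, gaussWeight]
  congr 3
  rw [map_neg]
  ring

theorem coeff_matrixWeight_eq_integral [Nonempty S.Half] (ε : S.Half → ℤˣ) {g : ℂ⟦X⟧}
    (hg : constantCoeff g = 0) (z : S.Coord o N → ℂ) (n : ℕ) :
    coeff n (matrixWeight S o N ε g z) = ((Real.pi : ℂ) ^ Fintype.card (Fin d → Fin N))⁻¹ *
      ∫ T : (Fin d → Fin N) → ℂ, coeff n (expSeries (mixedAction ε g z T)) *
        (gaussWeight z * gaussWeight T) := by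
  rw [coeff_matrixWeight, ← gaussSeries_expSeries_quadraticForm (constantCoeff_vertexSum ε hg z),
    coeff_gaussSeries_expSeries]
  simp_rw [map_quadraticForm_vertexSum, mul_left_comm _ (gaussWeight z)]
  rw [MeasureTheory.integral_const_mul]
  ring

theorem isPolyFun_mixedAction [Nonempty S.Half] (ho : S.IsOrientation o) (ε : S.Half → ℤˣ)
    (g : ℂ⟦X⟧) (n : ℕ) :
    IsPolyFun fun y : S.Coord o N ⊕ (Fin d → Fin N) → ℂ =>
      coeff n (mixedAction ε g (fun i => y (Sum.inl i)) fun a => y (Sum.inr a)) := by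
  simp only [mixedAction, sum_mul_prod_mul (S.deg_pos _), ← evalZ_matrixField ho]
  simp only [map_sum (coeff (R := ℂ) n), coeff_mul_C]
  refine IsPolyFun.sum _ fun v => ((IsPolyFun.const _).mul (IsPolyFun.sum _ fun J => ?_))
  refine IsPolyFun.mul ?_ (IsPolyFun.prod _ fun i => ?_)
  · simp only [chainCoef, dif_pos (S.deg_pos v)]
    exact ((IsPolyFun.conj_coord _).mul (IsPolyFun.coord _)).mul (IsPolyFun.const _)
  · exact IsPolyFun.comp (f := fun z => evalZ z _) ⟨_, fun _ => rfl⟩ Sum.inl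

open MeasureTheory in
theorem integrable_mixedAction [Nonempty S.Half] (ho : S.IsOrientation o) (ε : S.Half → ℤˣ)
    (g : ℂ⟦X⟧) (n : ℕ) :
    Integrable fun p : (S.Coord o N → ℂ) × ((Fin d → Fin N) → ℂ) =>
      coeff n (expSeries (mixedAction ε g p.1 p.2)) * (gaussWeight p.1 * gaussWeight p.2) :=
  (IsPolyFun.coeff_expSeries (isPolyFun_mixedAction ho ε g) n).integrable_prod

/-- Each coefficient is a marginal of a jointly integrable function of matrices and tensor. -/
theorem formallyIntegrable_matrixWeight [Nonempty S.Half] (ho : S.IsOrientation o)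
    (ε : S.Half → ℤˣ) {g : ℂ⟦X⟧} (hg : constantCoeff g = 0) :
    FormallyIntegrable (matrixWeight S o N ε g) := by
  intro n
  simp_rw [coeff_matrixWeight_eq_integral ε hg]
  exact (integrable_mixedAction ho ε g n).integral_prod_left.const_mul _

/-- The matrix integral at fixed tensor gives back the interaction of the bubble. -/
theorem integral_mixedAction [Nonempty S.Half] (hN : 0 < N) (ho : S.IsOrientation o)
    (ε : S.Half → ℤˣ) {g : ℂ⟦X⟧} (hg : constantCoeff g = 0) {B : ColoredGraph d}
    (hB : S.toGraph.IsBoundary B) (T : (Fin d → Fin N) → ℂ) (n : ℕ) :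
    ((Real.pi : ℂ) ^ Fintype.card (S.Coord o N))⁻¹ * ∫ z : S.Coord o N → ℂ,
        coeff n (expSeries (mixedAction ε g z T)) * gaussWeight z =
      coeff n (expSeries (C (B.poly T) * ∏ v, S.vertexCoupling ε g v)) := by
  -- With `N > 0` the index type is non-empty, as the cancellation of multiplicities requires.
  have : Nonempty (Fin N) := ⟨⟨0, hN⟩⟩
  rw [← fullContraction_eq_poly hB ho T,
    ← HalfEdgeField.gaussSeries_expSeries_interaction _ _ _ (constantCoeff_vertexCoupling ε hg),
    coeff_gaussSeries_expSeries]
  simp_rw [map_interaction]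

theorem coeff_matrixZ [Nonempty S.Half] (hN : 0 < N) (ho : S.IsOrientation o)
    (ε : S.Half → ℤˣ) {g : ℂ⟦X⟧} (hg : constantCoeff g = 0) {B : ColoredGraph d}
    (hB : S.toGraph.IsBoundary B) (n : ℕ) :
    coeff n (matrixZ S o N ε g) = ((Real.pi : ℂ) ^ Fintype.card (Fin d → Fin N))⁻¹ *
      ∫ T : (Fin d → Fin N) → ℂ,
        coeff n (expSeries (C (B.poly T) * ∏ v, S.vertexCoupling ε g v)) * gaussWeight T := by
  rw [matrixZ, formalIntegral, coeff_mk]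
  simp_rw [coeff_matrixWeight_eq_integral ε hg]
  rw [MeasureTheory.integral_const_mul,
    -- Exchange of the orders of integration: the tensor had been introduced inside the matrix
    -- integral, and the matrices are now integrated at fixed tensor.
    MeasureTheory.integral_integral_swap (integrable_mixedAction ho ε g n), mul_left_comm,
    ← MeasureTheory.integral_const_mul]
  congr 1
  refine MeasureTheory.integral_congr_ae (Filter.Eventually.of_forall fun T => ?_)
  dsimp only
  rw [← integral_mixedAction hN ho ε hg hB T n]
  simp_rw [← mul_assoc]
  rw [MeasureTheory.integral_mul_const, mul_assoc]

theorem prod_vertexCoupling (S : PlaneTree d) (ε : S.Half → ℤˣ) (hε : ∏ h, ε h = -1) (g : ℂ⟦X⟧) :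
    ∏ v, S.vertexCoupling ε g v = -g ^ Fintype.card S.Half := by
  have h1 : (∏ h : S.Half, (((ε h : ℤˣ) : ℤ) : ℂ)) = -1 := by
    rw [← Int.cast_prod, ← Units.coe_prod, hε]
    simp
  simp only [vertexCoupling]
  rw [← Fintype.prod_sigma' (f := fun v i => g * C (((ε ⟨v, i⟩ : ℤˣ) : ℤ) : ℂ)),
    Finset.prod_mul_distrib, Finset.prod_const, ← map_prod, Finset.card_univ]
  simp only [Sigma.eta]
  rw [h1, map_neg, map_one, mul_neg, mul_one]

end PlaneTree

/-- The matrix model of a plane tree computes the tensor model of the bubble that it encodes. -/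
theorem tensorZ_subst_eq_matrixZ {d N : ℕ} (hN : 0 < N) (s : ℝ) (B : ColoredGraph d)
    {S : PlaneTree d} [Nonempty S.Half] (hB : S.toGraph.IsBoundary B) {o : Finset S.Half}
    (ho : S.IsOrientation o) {ε : S.Half → ℤˣ} (hε : ∏ h, ε h = -1) :
    (tensorZ B N s).subst (X ^ (B.numVert - 2) : ℂ⟦X⟧) =
      matrixZ S o N ε (coupling N s B.numVert) := by
  have hg : constantCoeff (coupling N s B.numVert) = 0 := by simp [coupling]
  have hcard := PlaneTree.card_half_of_isBoundary hB
  have hpos := Fintype.card_pos (α := S.Half)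
  have hk : B.numVert - 2 ≠ 0 := by omega
  ext n
  rw [coeff_tensorZ_subst B N s hk, PlaneTree.coeff_matrixZ hN ho ε hg hB,
    S.prod_vertexCoupling ε hε, show Fintype.card S.Half = B.numVert - 2 by omega]
  -- One root of the coupling per half-edge recombines to `N^s`, because `N^s` is a nonnegative real
  -- and `V - 2` is nonzero.
  have hroot : (((N : ℝ) ^ s) ^ (1 / ((B.numVert : ℝ) - 2))) ^ (B.numVert - 2) = (N : ℝ) ^ s := by
    have h1 : ((B.numVert - 2 : ℕ) : ℝ) = (B.numVert : ℝ) - 2 := by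
      rw [Nat.cast_sub (by omega)]
      norm_num
    rw [← h1, one_div, Real.rpow_inv_natCast_pow (by positivity) hk]
  have hpow : coupling N s B.numVert ^ (B.numVert - 2) =
      C (((N : ℝ) ^ s : ℝ) : ℂ) * X ^ (B.numVert - 2) := by
    rw [coupling, mul_pow, ← map_pow, ← Complex.ofReal_pow, hroot]
  rw [hpow]
  congr 3
  funext T
  congr 3
  simp only [map_neg, map_mul]
  ring

end MatrixModel

/-! ### Existence of an encoding tree. -/

namespace ColoredGraph

variable {d : ℕ} {B B' B'' : ColoredGraph d}

theorem Iso.card_eq (h : B.Iso B') :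
    Fintype.card B.W = Fintype.card B'.W ∧ Fintype.card B.K = Fintype.card B'.K := by
  obtain ⟨f, g, -⟩ := h
  exact ⟨Fintype.card_congr f, Fintype.card_congr g⟩

/-- Exchanging the names of the two white vertices `v` and `w` exchanges `C` and its complement. -/
theorem insertWhite_compl_iso (B : ColoredGraph d) (C : Finset (Fin d)) (x : B.W) :
    (B.insertWhite Cᶜ x).Iso (B.insertWhite C x) := by
  refine ⟨Equiv.swap (some x) none, Equiv.refl _, fun c w => ?_⟩
  by_cases hc : c ∈ C
  · simp only [insertWhite, Finset.mem_compl, hc, not_true, if_false, if_true]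
    exact congrArg (Equiv.optionCongr (B.edge c)) (DFunLike.congr_fun (Equiv.swap_swap (some x) none) w).symm
  · simp only [insertWhite, Finset.mem_compl, hc, not_false_eq_true, if_false, if_true]
    rfl

theorem insertBlack_compl_iso (B : ColoredGraph d) (C : Finset (Fin d)) (y : B.K) :
    (B.insertBlack Cᶜ y).Iso (B.insertBlack C y) := by
  refine ⟨Equiv.refl _, Equiv.swap (some y) none, fun c w => ?_⟩
  by_cases hc : c ∈ C
  · simp only [insertBlack, Finset.mem_compl, hc, not_true, if_false, if_true]
    rfl
  · simp only [insertBlack, Finset.mem_compl, hc, not_false_eq_true, if_false, if_true]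
    exact DFunLike.congr_fun (Equiv.swap_swap (some y) none) (Equiv.optionCongr (B.edge c) w)

theorem insertWhite_edge (B : ColoredGraph d) (C : Finset (Fin d)) (x : B.W) (c : Fin d)
    (w : Option B.W) : (B.insertWhite C x).edge c w =
      if c ∈ C then (Equiv.swap (some x) none w).map (B.edge c) else w.map (B.edge c) := by
  change (if c ∈ C then _ else _ : Option B.W ≃ Option B.K) w = _
  split_ifs <;> rfl

theorem insertBlack_edge (B : ColoredGraph d) (C : Finset (Fin d)) (y : B.K) (c : Fin d)
    (w : Option B.W) : (B.insertBlack C y).edge c w =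
      if c ∈ C then Equiv.swap (some y) none (w.map (B.edge c)) else w.map (B.edge c) := by
  change (if c ∈ C then _ else _ : Option B.W ≃ Option B.K) w = _
  split_ifs <;> rfl

end ColoredGraph

/-- The smaller of the two sets is admissible; when both have `d / 2` elements, the one that
contains the first color is. -/
theorem admissible_or_compl {d : ℕ} {C : Finset (Fin d)} (h0 : C.Nonempty)
    (h1 : C ≠ Finset.univ) : Admissible C ∨ Admissible Cᶜ := by
  have hcard := Finset.card_add_card_compl C
  rw [Fintype.card_fin] at hcard
  have hne : Cᶜ.Nonempty := by
    rwa [Finset.nonempty_iff_ne_empty, Ne, Finset.compl_eq_empty_iff]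
  have hd : 0 < d := by
    have := h0.card_pos
    omega
  by_cases h2 : 2 * C.card ≤ d
  · by_cases h3 : 2 * C.card = d → ⟨0, hd⟩ ∈ C
    · exact Or.inl ⟨h0, h2, fun h => ⟨⟨0, hd⟩, h3 h, rfl⟩⟩
    · push Not at h3
      exact Or.inr ⟨hne, by omega, fun _ => ⟨⟨0, hd⟩, Finset.mem_compl.2 h3.2, rfl⟩⟩
  · exact Or.inr ⟨hne, by omega, fun h => by omega⟩

namespace DashedGraph

variable {d : ℕ} {G : DashedGraph d}

theorem Path.trans {c : Fin d} {w w' : G.W} {k k' : G.K} (h1 : G.Path c w k) (h : G.dash w' k)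
    (h2 : G.Path c w' k') : G.Path c w k' := by
  induction h2 with
  | single => exact h1.step _ _ _ h
  | step k' w'' _ hd ih => exact ih.step _ _ _ hd

theorem Path.of_edge_eq {c : Fin d} {w : G.W} {k : G.K} (h : G.edge c w = k) : G.Path c w k :=
  h ▸ Path.single w

theorem IsBoundary.of_iso {B B' : ColoredGraph d} (h : G.IsBoundary B) (hB : B.Iso B') :
    G.IsBoundary B' := by
  obtain ⟨f, g, hp⟩ := h
  obtain ⟨f', g', he⟩ := hB
  refine ⟨f'.symm.trans f, g'.symm.trans g, fun c w => ?_⟩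
  have := hp c (f'.symm w)
  have h2 := he c (f'.symm w)
  rw [Equiv.apply_symm_apply] at h2
  rw [Equiv.trans_apply, Equiv.trans_apply, ← h2, Equiv.symm_apply_apply]
  exact this

end DashedGraph

namespace PlaneTree

variable {d : ℕ}

theorem isBoundary_of_equiv {S : PlaneTree d} [Nonempty S.Half] {B : ColoredGraph d}
    (f : B.W ≃ S.Vert) (g : B.K ≃ S.Vert)
    (h : ∀ c w, S.toGraph.Path c (S.lastHalf (f w)) (S.firstHalf (g (B.edge c w)))) :
    S.toGraph.IsBoundary B :=
  ⟨f.trans S.unmatchedWhite.symm, g.trans S.unmatchedBlack.symm, h⟩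

/-- The tree with a single edge. -/
def singleEdge (C : Finset (Fin d)) (hC : Admissible C) : PlaneTree d where
  Vert := Bool
  deg _ := 1
  twin h := ⟨!h.1, 0⟩
  twin_twin := by
    rintro ⟨b, i⟩
    rw [Bool.not_not, Subsingleton.elim i 0]
  twin_ne := by
    rintro ⟨b, i⟩ h
    exact Bool.not_ne_self b (congrArg Sigma.fst h)
  color _ := C
  color_twin _ := rfl
  color_admissible _ := hC
  connected := by
    rw [SimpleGraph.connected_iff_exists_forall_reachable]
    refine ⟨false, fun b => ?_⟩
    cases b
    · exact SimpleGraph.Reachable.refl _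
    · refine SimpleGraph.Adj.reachable ?_
      rw [SimpleGraph.fromRel_adj]
      exact ⟨Bool.false_ne_true, Or.inl ⟨⟨false, 0⟩, rfl, rfl⟩⟩
  card_vert := by simp

theorem isBoundary_singleEdge {C : Finset (Fin d)} (hC : Admissible C) {B : ColoredGraph d}
    (f : B.W ≃ Bool) (g : B.K ≃ Bool)
    (h : ∀ c w, g (B.edge c w) = if c ∈ C then !f w else f w) :
    (singleEdge C hC).toGraph.IsBoundary B := by
  have : Nonempty (singleEdge C hC).Half := ⟨⟨false, ⟨0, one_pos⟩⟩⟩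
  refine isBoundary_of_equiv f g fun c w => DashedGraph.Path.of_edge_eq ?_
  have hb : ∀ b b' : Bool, b' = (if c ∈ C then !b else b) →
      (singleEdge C hC).edgePerm c ((singleEdge C hC).lastHalf b) =
        (singleEdge C hC).firstHalf b' := by
    rintro b _ rfl
    change (if c ∈ C then _ else _) = _
    split_ifs <;> rfl
  exact hb _ _ (h c w)

/-- A bidipole insertion in the two-vertex bubble. -/
theorem exists_isBoundary_of_card_eq_one {B : ColoredGraph d} (hW : Fintype.card B.W = 1)
    (hK : Fintype.card B.K = 1) {C : Finset (Fin d)} (hC : Admissible C) :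
    (∀ x, (singleEdge C hC).toGraph.IsBoundary (B.insertWhite C x)) ∧
      ∀ y, (singleEdge C hC).toGraph.IsBoundary (B.insertBlack C y) := by
  have hbij : ∀ {α : Type} [Fintype α], Fintype.card α = 1 →
      Function.Bijective (Option.isSome : Option α → Bool) := by
    intro α _ hα
    obtain ⟨a, ha⟩ := Fintype.card_eq_one_iff.1 hα
    constructor
    · rintro (_ | x) (_ | y) h
      · rfl
      · simp at h
      · simp at h
      · rw [ha x, ha y]
    · rintro (_ | _)
      · exact ⟨none, rfl⟩
      · exact ⟨some a, rfl⟩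
  have hW' := Fintype.card_le_one_iff.1 hW.le
  have hK' := Fintype.card_le_one_iff.1 hK.le
  constructor
  · intro x
    refine isBoundary_singleEdge hC (Equiv.ofBijective _ (hbij hW)) (Equiv.ofBijective _ (hbij hK))
      fun c w => ?_
    refine (congrArg Option.isSome (B.insertWhite_edge C x c w)).trans ?_
    change _ = if c ∈ C then !Option.isSome w else Option.isSome w
    rcases w with _ | w
    · split_ifs <;> simp
    · rw [hW' w x]
      split_ifs <;> simp
  · intro y
    refine isBoundary_singleEdge hC (Equiv.ofBijective _ (hbij hW)) (Equiv.ofBijective _ (hbij hK))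
      fun c w => ?_
    refine (congrArg Option.isSome (B.insertBlack_edge C y c w)).trans ?_
    change _ = if c ∈ C then !Option.isSome w else Option.isSome w
    rcases w with _ | w
    · split_ifs <;> simp
    · simp only [Option.map_some, hK' (B.edge c w) y]
      split_ifs <;> simp

section Grow

variable (S : PlaneTree d) (v : S.Vert) (k : ℕ)

open Classical in
/-- The degrees after a leaf has been attached to `v`. -/
noncomputable def growDeg : Option S.Vert → ℕ
  | none => 1
  | some u => if u = v then S.deg u + 1 else S.deg u

theorem growDeg_self : S.growDeg v (some v) = S.deg v + 1 := if_pos rfl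

variable {k} in
open Classical in
/-- The position of the half-edges after a leaf has been attached to `v` by a half-edge
(`Sum.inr true`) in position `k`. -/
noncomputable def growPos (hk : k ≤ S.deg v) : S.Half ⊕ Bool → Σ u, Fin (S.growDeg v u)
  | Sum.inl h => ⟨some h.1, ⟨if h.1 = v ∧ k ≤ h.2 then h.2 + 1 else h.2, by
      have := h.2.2
      rw [growDeg]
      split_ifs <;> grind⟩⟩
  | Sum.inr true => ⟨some v, ⟨k, by rw [growDeg_self]; omega⟩⟩
  | Sum.inr false => ⟨none, ⟨0, one_pos⟩⟩

variable {k}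

theorem growPos_injective (hk : k ≤ S.deg v) : Function.Injective (S.growPos v hk) := by
  have hval : ∀ {p q : Σ u, Fin (S.growDeg v u)}, p = q → (p.2 : ℕ) = q.2 := by
    rintro p _ rfl
    rfl
  rintro (⟨u, i⟩ | (_ | _)) (⟨u', i'⟩ | (_ | _)) h
  · have h1 : u = u' := Option.some.inj (congrArg Sigma.fst h)
    subst h1
    have h2 := hval h
    simp only [growPos] at h2
    have : i = i' := Fin.ext (by split_ifs at h2 <;> grind)
    rw [this]
  · exact absurd (congrArg Sigma.fst h) (by simp [growPos])
  · have h1 : u = v := Option.some.inj (congrArg Sigma.fst h)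
    have h2 := hval h
    simp only [growPos] at h2
    exfalso
    split_ifs at h2 <;> grind
  · exact absurd (congrArg Sigma.fst h) (by simp [growPos])
  · rfl
  · exact absurd (congrArg Sigma.fst h) (by simp [growPos])
  · have h1 : v = u' := Option.some.inj (congrArg Sigma.fst h)
    have h2 := hval h
    simp only [growPos] at h2
    exfalso
    split_ifs at h2 <;> grind
  · exact absurd (congrArg Sigma.fst h) (by simp [growPos])
  · rfl

theorem card_grow : Fintype.card (Σ u, Fin (S.growDeg v u)) = Fintype.card S.Half + 2 := by
  classical
  have h : ∀ u, S.growDeg v (some u) = S.deg u + if u = v then 1 else 0 := by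
    intro u
    rw [growDeg]
    split_ifs <;> rfl
  rw [Fintype.card_sigma, Fintype.card_sigma, Fintype.sum_option]
  simp only [Fintype.card_fin, h, Finset.sum_add_distrib, Finset.sum_ite_eq', Finset.mem_univ,
    if_true]
  change 1 + _ = _
  ring

/-- The half-edges after a leaf has been attached. -/
noncomputable def growEquiv (hk : k ≤ S.deg v) : S.Half ⊕ Bool ≃ Σ u, Fin (S.growDeg v u) :=
  Equiv.ofBijective (S.growPos v hk) ((Fintype.bijective_iff_injective_and_card _).2
    ⟨S.growPos_injective v hk, by rw [card_grow, Fintype.card_sum, Fintype.card_bool]⟩)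

/-- The tree with a new leaf attached to `v` by an edge with color set `C`. -/
noncomputable def grow (hk : k ≤ S.deg v) (C : Finset (Fin d)) (hC : Admissible C) :
    PlaneTree d where
  Vert := Option S.Vert
  deg := S.growDeg v
  twin h := S.growEquiv v hk (Sum.map S.twin not ((S.growEquiv v hk).symm h))
  twin_twin h := by
    obtain ⟨x, rfl⟩ := (S.growEquiv v hk).surjective h
    rw [Equiv.symm_apply_apply, Equiv.symm_apply_apply]
    rcases x with x | b
    · exact congrArg (fun y => S.growEquiv v hk (Sum.inl y)) (S.twin_twin x)
    · exact congrArg (fun y => S.growEquiv v hk (Sum.inr y)) (Bool.not_not b)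
  twin_ne h := by
    obtain ⟨x, rfl⟩ := (S.growEquiv v hk).surjective h
    rw [Equiv.symm_apply_apply, (S.growEquiv v hk).injective.ne_iff]
    rcases x with x | b
    · exact fun hx => S.twin_ne x (Sum.inl_injective hx)
    · exact fun hx => Bool.not_ne_self b (Sum.inr_injective hx)
  color h := Sum.elim S.color (fun _ => C) ((S.growEquiv v hk).symm h)
  color_twin h := by
    rw [Equiv.symm_apply_apply]
    rcases (S.growEquiv v hk).symm h with x | b
    · exact S.color_twin x
    · rfl
  color_admissible h := by
    rcases (S.growEquiv v hk).symm h with h | b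
    · exact S.color_admissible h
    · exact hC
  connected := by
    rw [SimpleGraph.connected_iff_exists_forall_reachable]
    have hrel : ∀ x : S.Half ⊕ Bool, ∃ h : Σ u, Fin (S.growDeg v u),
        h.1 = (S.growPos v hk x).1 ∧
        (S.growEquiv v hk (Sum.map S.twin not ((S.growEquiv v hk).symm h))).1 =
          (S.growPos v hk (Sum.map S.twin not x)).1 := by
      intro x
      refine ⟨S.growEquiv v hk x, rfl, ?_⟩
      rw [Equiv.symm_apply_apply]
      rfl
    refine ⟨some v, fun u => ?_⟩
    rcases u with _ | u
    · refine SimpleGraph.Adj.reachable ?_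
      rw [SimpleGraph.fromRel_adj]
      exact ⟨Option.some_ne_none v, Or.inl (hrel (Sum.inr true))⟩
    · refine (S.connected v u).map ⟨some, fun {a b} hab => ?_⟩
      rw [SimpleGraph.fromRel_adj] at hab ⊢
      refine ⟨fun h => hab.1 (Option.some.inj h), hab.2.imp ?_ ?_⟩
      · rintro ⟨h, rfl, rfl⟩
        exact hrel (Sum.inl h)
      · rintro ⟨h, rfl, rfl⟩
        exact hrel (Sum.inl h)
  card_vert := by
    have : 2 * Fintype.card S.Vert = Fintype.card S.Half + 2 := S.card_vert
    rw [card_grow, Fintype.card_option]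
    omega

variable {S v} (hk : k ≤ S.deg v) {C : Finset (Fin d)} (hC : Admissible C)

/-- The old half-edges and the two new ones, as half-edges of the new tree. -/
noncomputable def growHalf : S.Half ⊕ Bool ≃ (S.grow v hk C hC).Half := S.growEquiv v hk

instance : Nonempty (S.grow v hk C hC).Half := ⟨growHalf hk hC (Sum.inr true)⟩

theorem grow_edge_inl (c : Fin d) (h : S.Half) :
    (S.grow v hk C hC).edgePerm c (growHalf hk hC (Sum.inl h)) =
      growHalf hk hC (Sum.inl (S.edgePerm c h)) := by
  change (if c ∈ Sum.elim S.color (fun _ => C)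
      ((S.growEquiv v hk).symm (S.growEquiv v hk (Sum.inl h))) then
        S.growEquiv v hk (Sum.map S.twin not
          ((S.growEquiv v hk).symm (S.growEquiv v hk (Sum.inl h))))
      else S.growEquiv v hk (Sum.inl h)) =
    S.growEquiv v hk (Sum.inl (if c ∈ S.color h then S.twin h else h))
  rw [Equiv.symm_apply_apply, Sum.elim_inl]
  split_ifs <;> rfl

theorem grow_edge_inr (c : Fin d) (b : Bool) :
    (S.grow v hk C hC).edgePerm c (growHalf hk hC (Sum.inr b)) =
      growHalf hk hC (Sum.inr (if c ∈ C then !b else b)) := by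
  change (if c ∈ Sum.elim S.color (fun _ => C)
      ((S.growEquiv v hk).symm (S.growEquiv v hk (Sum.inr b))) then
        S.growEquiv v hk (Sum.map S.twin not
          ((S.growEquiv v hk).symm (S.growEquiv v hk (Sum.inr b))))
      else S.growEquiv v hk (Sum.inr b)) =
    S.growEquiv v hk (Sum.inr (if c ∈ C then !b else b))
  rw [Equiv.symm_apply_apply, Sum.elim_inr]
  split_ifs <;> rfl

theorem half_ext {h h' : S.Half} (h1 : h.1 = h'.1) (h2 : (h.2 : ℕ) = h'.2) : h = h' := by
  obtain ⟨u, i⟩ := h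
  obtain ⟨u', i'⟩ := h'
  dsimp only at h1
  subst h1
  exact congrArg (Sigma.mk u) (Fin.ext h2)

open Classical in
theorem growHalf_inl_snd (h : S.Half) : ((growHalf hk hC (Sum.inl h)).2 : ℕ) =
    if h.1 = v ∧ k ≤ h.2 then (h.2 : ℕ) + 1 else h.2 := rfl

/-- A half-edge added in first or last position is next to the marked corner, so it separates no two
consecutive old half-edges and all dashed lines survive. -/
theorem growHalf_follows (hk' : k = 0 ∨ k = S.deg v) {h h' : S.Half} (hf : S.Follows h h') :
    (S.grow v hk C hC).Follows (growHalf hk hC (Sum.inl h)) (growHalf hk hC (Sum.inl h')) := by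
  obtain ⟨u, i⟩ := h
  obtain ⟨u', i'⟩ := h'
  obtain ⟨h1, h2⟩ := hf
  dsimp only at h1 h2
  subst h1
  refine ⟨rfl, ?_⟩
  rw [growHalf_inl_snd, growHalf_inl_snd]
  dsimp only
  by_cases hu : u = v
  · subst hu
    have := i.2
    have := i'.2
    split_ifs <;> grind
  · simp only [hu, false_and, if_false, h2]

theorem growHalf_path (hk' : k = 0 ∨ k = S.deg v) {c : Fin d} {h : S.toGraph.W}
    {h' : S.toGraph.K} (hp : S.toGraph.Path c h h') : (S.grow v hk C hC).toGraph.Path c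
      (growHalf hk hC (Sum.inl h)) (growHalf hk hC (Sum.inl h')) := by
  induction hp with
  | single => exact DashedGraph.Path.of_edge_eq (grow_edge_inl hk hC c _)
  | step k' w _ hd ih =>
    have h1 := ih.step _ _ _ (growHalf_follows hk hC hk' hd)
    exact (grow_edge_inl hk hC c w) ▸ h1

theorem path_inr (c : Fin d) (b b' : Bool) (hb : (if c ∈ C then !b else b) = b') :
    (S.grow v hk C hC).toGraph.Path c
      (growHalf hk hC (Sum.inr b)) (growHalf hk hC (Sum.inr b')) :=
  DashedGraph.Path.of_edge_eq (hb ▸ grow_edge_inr hk hC c b)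

theorem grow_lastHalf_last :
    (S.grow v le_rfl C hC).lastHalf (some v) = growHalf le_rfl hC (Sum.inr true) :=
  half_ext rfl (congrArg (· - 1) (S.growDeg_self v))

variable [Nonempty S.Half]

theorem grow_lastHalf_of_ne {u : S.Vert} (hu : u ≠ v) :
    (S.grow v hk C hC).lastHalf (some u) = growHalf hk hC (Sum.inl (S.lastHalf u)) := by
  refine half_ext rfl ?_
  rw [growHalf_inl_snd, if_neg (fun h => hu h.1)]
  exact congrArg (· - 1) (if_neg hu)

theorem grow_firstHalf_of_ne {u : S.Vert} (hu : u ≠ v) :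
    (S.grow v hk C hC).firstHalf (some u) = growHalf hk hC (Sum.inl (S.firstHalf u)) := by
  refine half_ext rfl ?_
  rw [growHalf_inl_snd, if_neg (fun h => hu h.1)]
  rfl

theorem grow_firstHalf_last (u : S.Vert) :
    (S.grow v le_rfl C hC).firstHalf (some u) = growHalf le_rfl hC (Sum.inl (S.firstHalf u)) := by
  refine half_ext rfl ?_
  rw [growHalf_inl_snd, if_neg (fun h => (S.deg_pos v).not_ge h.2)]
  rfl

theorem grow_follows_last : (S.grow v le_rfl C hC).Follows
    (growHalf le_rfl hC (Sum.inl (S.lastHalf v))) (growHalf le_rfl hC (Sum.inr true)) := by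
  refine ⟨rfl, ?_⟩
  have := S.deg_pos v
  rw [growHalf_inl_snd, if_neg]
  · exact Nat.sub_add_cancel this
  · rintro ⟨-, h⟩
    change S.deg v ≤ S.deg v - 1 at h
    omega

theorem grow_lastHalf_first (u : S.Vert) : (S.grow v (Nat.zero_le _) C hC).lastHalf (some u) =
    growHalf (Nat.zero_le _) hC (Sum.inl (S.lastHalf u)) := by
  by_cases hu : u = v
  · subst hu
    refine half_ext rfl ?_
    rw [growHalf_inl_snd, if_pos ⟨rfl, Nat.zero_le _⟩]
    exact (congrArg (· - 1) (S.growDeg_self u)).trans (Nat.sub_add_cancel (S.deg_pos u)).symm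
  · exact grow_lastHalf_of_ne _ hC hu

theorem grow_follows_first : (S.grow v (Nat.zero_le _) C hC).Follows
    (growHalf (Nat.zero_le _) hC (Sum.inr true))
    (growHalf (Nat.zero_le _) hC (Sum.inl (S.firstHalf v))) := by
  refine ⟨rfl, ?_⟩
  rw [growHalf_inl_snd, if_pos ⟨rfl, Nat.zero_le _⟩]
  rfl

/-- The leaf is attached last, just before the marked corner of `f x`. The new half-edge there
carries `w`, the leaf carries `v` and `v̄`, and the former last half-edge is now reached through a
dashed line. Hence old edges at `x` start from the leaf if their color is in `C` and from `w`
otherwise. -/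
theorem isBoundary_grow_insertWhite {B : ColoredGraph d} (f : B.W ≃ S.Vert) (g : B.K ≃ S.Vert)
    (h : ∀ c w, S.toGraph.Path c (S.lastHalf (f w)) (S.firstHalf (g (B.edge c w)))) (x : B.W) :
    (S.grow (f x) le_rfl C hC).toGraph.IsBoundary (B.insertWhite C x) := by
  let S' := S.grow (f x) le_rfl C hC
  have hlift : ∀ c w, S'.toGraph.Path c (growHalf le_rfl hC (Sum.inl (S.lastHalf (f w))))
      (S'.firstHalf (some (g (B.edge c w)))) := fun c w => by
    rw [grow_firstHalf_last]
    exact growHalf_path _ hC (Or.inr rfl) (h c w)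
  have key : ∀ c (w : Option B.W) (w' : Option B.K), w' = (if c ∈ C then
      (Equiv.swap (some x) none w).map (B.edge c) else w.map (B.edge c)) →
      S'.toGraph.Path c (S'.lastHalf (w.map f)) (S'.firstHalf (w'.map g)) := by
    rintro c w _ rfl
    have htrue : ∀ (b : Bool), (if c ∈ C then !b else b) = true →
        S'.toGraph.Path c (growHalf le_rfl hC (Sum.inr b))
          (S'.firstHalf (some (g (B.edge c x)))) := fun b hb =>
      (path_inr le_rfl hC c b true hb).trans (grow_follows_last hC) (hlift c x)
    rcases w with _ | w
    · by_cases hc : c ∈ C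
      · rw [if_pos hc, Equiv.swap_apply_right]
        exact htrue false (if_pos hc)
      · rw [if_neg hc]
        exact path_inr le_rfl hC c false false (if_neg hc)
    · by_cases hw : w = x
      · subst hw
        rw [Option.map_some, grow_lastHalf_last]
        by_cases hc : c ∈ C
        · rw [if_pos hc, Equiv.swap_apply_left]
          exact path_inr le_rfl hC c true false (if_pos hc)
        · rw [if_neg hc]
          exact htrue true (if_neg hc)
      · rw [Equiv.swap_apply_of_ne_of_ne (fun h => hw (Option.some.inj h)) (Option.some_ne_none w),
          ite_self, Option.map_some, grow_lastHalf_of_ne le_rfl hC (fun h => hw (f.injective h))]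
        exact hlift c w
  exact isBoundary_of_equiv (Equiv.optionCongr f) (Equiv.optionCongr g) fun c w =>
    key c w _ (B.insertWhite_edge C x c w)

/-- Mirror image of the white case: the leaf is attached first, just after the marked corner, so
that paths are extended at their end instead of their start. -/
theorem isBoundary_grow_insertBlack {B : ColoredGraph d} (f : B.W ≃ S.Vert) (g : B.K ≃ S.Vert)
    (h : ∀ c w, S.toGraph.Path c (S.lastHalf (f w)) (S.firstHalf (g (B.edge c w)))) (y : B.K) :
    (S.grow (g y) (Nat.zero_le _) C hC).toGraph.IsBoundary (B.insertBlack C y) := by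
  let S' := S.grow (g y) (Nat.zero_le _) C hC
  have hlift : ∀ c w, S'.toGraph.Path c (S'.lastHalf (some (f w)))
      (growHalf (Nat.zero_le _) hC (Sum.inl (S.firstHalf (g (B.edge c w))))) := fun c w => by
    rw [grow_lastHalf_first]
    exact growHalf_path _ hC (Or.inl rfl) (h c w)
  have key : ∀ c (w : Option B.W) (w' : Option B.K), w' = (if c ∈ C then
      Equiv.swap (some y) none (w.map (B.edge c)) else w.map (B.edge c)) →
      S'.toGraph.Path c (S'.lastHalf (w.map f)) (S'.firstHalf (w'.map g)) := by
    intro c w w' hw'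
    rcases w with _ | w
    · rw [Option.map_none] at hw'
      by_cases hc : c ∈ C
      · rw [if_pos hc, Equiv.swap_apply_right] at hw'
        subst hw'
        exact path_inr (Nat.zero_le _) hC c false true (if_pos hc)
      · rw [if_neg hc] at hw'
        subst hw'
        exact path_inr (Nat.zero_le _) hC c false false (if_neg hc)
    · rw [Option.map_some] at hw'
      have hl := hlift c w
      by_cases hw : B.edge c w = y
      · rw [hw] at hl hw'
        have hend : ∀ b : Bool, (if c ∈ C then !true else true) = b →
            S'.toGraph.Path c (S'.lastHalf (some (f w))) (growHalf (Nat.zero_le _) hC (Sum.inr b)) :=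
          fun b hb => hl.trans (grow_follows_first hC) (path_inr (Nat.zero_le _) hC c true b hb)
        by_cases hc : c ∈ C
        · rw [if_pos hc, Equiv.swap_apply_left] at hw'
          subst hw'
          exact hend false (if_pos hc)
        · rw [if_neg hc] at hw'
          subst hw'
          exact hend true (if_neg hc)
      · rw [Equiv.swap_apply_of_ne_of_ne (fun h => hw (Option.some.inj h)) (Option.some_ne_none _),
          ite_self] at hw'
        subst hw'
        have hne : g (B.edge c w) ≠ g y := fun h => hw (g.injective h)
        exact (grow_firstHalf_of_ne (Nat.zero_le _) hC hne) ▸ hl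
  exact isBoundary_of_equiv (Equiv.optionCongr f) (Equiv.optionCongr g) fun c w =>
    key c w _ (B.insertBlack_edge C y c w)

end Grow

end PlaneTree

/-- The two-vertex bubble needs its own alternative, since a tree without edges has an empty
boundary and so does not encode it; an insertion in it gives the tree with one edge. -/
theorem exists_isBoundary_insert {d : ℕ} {B : ColoredGraph d}
    (hB : (∃ S : PlaneTree d, S.toGraph.IsBoundary B) ∨
      Fintype.card B.W = 1 ∧ Fintype.card B.K = 1) {C : Finset (Fin d)} (hC : Admissible C) :
    (∀ x, ∃ S : PlaneTree d, S.toGraph.IsBoundary (B.insertWhite C x)) ∧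
      ∀ y, ∃ S : PlaneTree d, S.toGraph.IsBoundary (B.insertBlack C y) := by
  rcases hB with ⟨S, hS⟩ | ⟨hW, hK⟩
  · constructor
    · intro x
      have : Nonempty S.Half := ⟨(hS.choose x).1⟩
      obtain ⟨f, g, h⟩ := PlaneTree.exists_equiv_of_isBoundary hS
      exact ⟨_, PlaneTree.isBoundary_grow_insertWhite hC f g h x⟩
    · intro y
      have : Nonempty S.Half := ⟨(hS.choose_spec.choose y).1⟩
      obtain ⟨f, g, h⟩ := PlaneTree.exists_equiv_of_isBoundary hS
      exact ⟨_, PlaneTree.isBoundary_grow_insertBlack hC f g h y⟩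
  · have h := PlaneTree.exists_isBoundary_of_card_eq_one hW hK hC
    exact ⟨fun x => ⟨_, h.1 x⟩, fun y => ⟨_, h.2 y⟩⟩

/-- Generalized melonic bubbles other than the two-vertex one are encoded by plane trees. -/
theorem ColoredGraph.IsGM.exists_isBoundary {d : ℕ} {B : ColoredGraph d} (hB : B.IsGM) :
    (∃ S : PlaneTree d, S.toGraph.IsBoundary B) ∨
      Fintype.card B.W = 1 ∧ Fintype.card B.K = 1 := by
  induction hB with
  | two => exact Or.inr ⟨Fintype.card_unit, Fintype.card_unit⟩
  | insertWhite B C x _ h0 h1 ih =>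
    left
    rcases admissible_or_compl h0 h1 with hC | hC
    · exact (exists_isBoundary_insert ih hC).1 x
    · obtain ⟨S, hS⟩ := (exists_isBoundary_insert ih hC).1 x
      exact ⟨S, hS.of_iso (B.insertWhite_compl_iso C x)⟩
  | insertBlack B C y _ h0 h1 ih =>
    left
    rcases admissible_or_compl h0 h1 with hC | hC
    · exact (exists_isBoundary_insert ih hC).2 y
    · obtain ⟨S, hS⟩ := (exists_isBoundary_insert ih hC).2 y
      exact ⟨S, hS.of_iso (B.insertBlack_compl_iso C y)⟩
  | iso B B' hiso _ ih =>
    obtain ⟨h1, h2⟩ := hiso.card_eq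
    rcases ih with ⟨S, hS⟩ | h
    · exact Or.inl ⟨S, hS.of_iso hiso⟩
    · rw [h1, h2] at h
      exact Or.inr h

end GMModel

theorem theorem4 {d N : ℕ} (hd : 2 < d) (hN : 0 < N) (s : ℝ)
    (B : GMModel.ColoredGraph d) (hB : B.IsGM) (hV : 2 < B.numVert) :
    (∃ S : GMModel.PlaneTree d, S.toGraph.IsBoundary B) ∧
    GMModel.FormallyIntegrable (GMModel.tensorWeight B N s) ∧
    ∀ S : GMModel.PlaneTree d, S.toGraph.IsBoundary B →
      ∀ o : Finset S.Half, S.IsOrientation o →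
      ∀ ε : S.Half → ℤˣ, ∏ h, ε h = -1 →
        GMModel.FormallyIntegrable
          (GMModel.matrixWeight S o N ε (GMModel.coupling N s B.numVert)) ∧
        (GMModel.tensorZ B N s).subst (PowerSeries.X ^ (B.numVert - 2) : PowerSeries ℂ) =
          GMModel.matrixZ S o N ε (GMModel.coupling N s B.numVert) := by
  refine ⟨?_, GMModel.formallyIntegrable_tensorWeight B N s, fun S hS o ho ε hε => ?_⟩
  · rcases hB.exists_isBoundary with h | ⟨h1, h2⟩
    · exact h
    · rw [GMModel.ColoredGraph.numVert, h1, h2] at hV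
      exact absurd hV (lt_irrefl 2)
  · have := GMModel.PlaneTree.nonempty_half_of_isBoundary hS hV
    exact ⟨GMModel.PlaneTree.formallyIntegrable_matrixWeight ho ε (by simp [GMModel.coupling]),
      GMModel.tensorZ_subst_eq_matrixZ hN s B hS ho hε⟩
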